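/- Let $M(\phi,\xi,\eta,g_M)$ be a cosymplectic manifold of dimension $2m+1$, that is, a smooth Riemannian manifold with a smooth $(1,1)$-tensor field $\phi$, a smooth vector field $\xi$ and a smooth $1$-form $\eta$ such that $\phi^2=-I+\eta\otimes\xi$, $\phi\xi=0$, $\eta\circ\phi=0$, $\eta(\xi)=1$, $g_M(\phi X,\phi Y)=g_M(X,Y)-\eta(X)\eta(Y)$, $\eta(X)=g_M(X,\xi)$, which is normal, i.e. $[\phi,\phi]+2\,d\eta\otimes\xi=0$ with $[\phi,\phi]$ the Nijenhuis tensor of $\phi$, and for which the forms $\eta$ and $\Phi(X,Y)=g_M(X,\phi Y)$ are closed. Let $(N,g_N)$ be a Riemannian manifold and let $F:M\to N$ be an anti-invariant Riemannian submersion, that is, a smooth surjective submersion such that $F_*$ preserves the lengths of horizontal vectors (those in $(\ker F_*)^\perp$) and $\phi(\ker F_*)\subseteq(\ker F_*)^\perp$. Suppose moreover that $\phi(\ker F_*)=(\ker F_*)^\perp$. Let $\nabla$ be the Levi-Civita connection of $g_M$, let $\mathcal V$ and $\mathcal H$ be the orthogonal projections onto $\ker F_*$ and $(\ker F_*)^\perp$,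 and let $$\mathcal T_EG=\mathcal H\nabla_{\mathcal VE}\mathcal VG+\mathcal V\nabla_{\mathcal VE}\mathcal HG,\qquad \mathcal A_EG=\mathcal V\nabla_{\mathcal HE}\mathcal HG+\mathcal H\nabla_{\mathcal HE}\mathcal VG$$ be O'Neill's tensors. Then $F$ is a totally geodesic map, i.e. $(\nabla F_*)(X,Y)=\nabla^F_X F_*Y-F_*(\nabla_XY)=0$ for all smooth vector fields $X,Y$ on $M$, where $\nabla^F$ is the pullback to $F^{-1}TN$ of the Levi-Civita connection of $g_N$, if and only if $$\mathcal T_W\phi V=0\quad\text{for all } W,V\in\Gamma(\ker F_*)$$ and $$\mathcal A_X\phi W=0\quad\text{for all } X\in\Gamma((\ker F_*)^\perp),\ W\in\Gamma(\ker F_*).$$ -/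

import Mathlib

open Bundle
open scoped Manifold ContDiff Topology

noncomputable section

namespace RiemGeom

section VectorFields

variable {E : Type*} [NormedAddCommGroup E] [NormedSpace ℝ E]
  {H : Type*} [TopologicalSpace H] (I : ModelWithCorners ℝ E H)
  {M : Type*} [TopologicalSpace M] [ChartedSpace H M]

/-- `X` is a `C^∞` vector field on `M`. -/
def IsSmoothField [IsManifold I ∞ M] (X : Π x : M, TangentSpace I x) : Prop :=
  ContMDiff I I.tangent ∞ (fun x ↦ (⟨x, X x⟩ : TangentBundle I M))

instance instFiniteDimensionalTangentSpace [FiniteDimensional ℝ E] (x : M) :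
    FiniteDimensional ℝ (TangentSpace I x) :=
  inferInstanceAs (FiniteDimensional ℝ E)

end VectorFields

/-! ### The Levi-Civita connection of a Riemannian manifold -/

section LeviCivita

variable {E : Type*} [NormedAddCommGroup E] [NormedSpace ℝ E]
  {H : Type*} [TopologicalSpace H] (I : ModelWithCorners ℝ E H)
  {M : Type*} [TopologicalSpace M] [ChartedSpace H M] [IsManifold I ∞ M]
  [RiemannianBundle (fun x : M ↦ TangentSpace I x)]

/-- The right-hand side of the Koszul formula for `2 ⟨∇_X Y, Z⟩`. -/
def koszul (X Y Z : Π x : M, TangentSpace I x) (x : M) : ℝ :=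
  mvfderiv I (fun y ↦ inner ℝ (Y y) (Z y)) x (X x)
    + mvfderiv I (fun y ↦ inner ℝ (Z y) (X y)) x (Y x)
    - mvfderiv I (fun y ↦ inner ℝ (X y) (Y y)) x (Z x)
    + inner ℝ (VectorField.mlieBracket I X Y x) (Z x)
    - inner ℝ (VectorField.mlieBracket I Y Z x) (X x)
    + inner ℝ (VectorField.mlieBracket I Z X x) (Y x)

variable [IsContMDiffRiemannianBundle I ∞ E (fun x : M ↦ TangentSpace I x)]

theorem mdifferentiableAt_inner {X Y : Π x : M, TangentSpace I x} {x : M}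
    (hX : MDiffAt (T% X) x) (hY : MDiffAt (T% Y) x) :
    MDiffAt (fun y ↦ (inner ℝ (X y) (Y y) : ℝ)) x :=
  MDifferentiableAt.inner_bundle (IB := I) (F := E) (E := fun x : M ↦ TangentSpace I x) hX hY

variable [CompleteSpace E]


theorem koszul_tensorial_left {Y Z : Π x : M, TangentSpace I x} {x : M}
    (hY : MDiffAt (T% Y) x) (hZ : MDiffAt (T% Z) x) :
    TensorialAt I E (fun X ↦ koszul I X Y Z x) x where
  smul {f X} hf hX := by
    simp [koszul, inner_smul_left, inner_smul_right, mvfderiv_fun_mul hf (mdifferentiableAt_inner I hZ hX),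
      mvfderiv_fun_mul hf (mdifferentiableAt_inner I hY hX), VectorField.mlieBracket_smul_left hf hX,
      VectorField.mlieBracket_smul_right hf hX, inner_add_left, real_inner_comm]
    ring
  add {X X'} hX hX' := by
    simp [koszul, inner_add_left, inner_add_right,
      mvfderiv_fun_add (mdifferentiableAt_inner I hZ hX) (mdifferentiableAt_inner I hZ hX'),
      mvfderiv_fun_add (mdifferentiableAt_inner I hX hY) (mdifferentiableAt_inner I hX' hY),
      VectorField.mlieBracket_add_left hX hX',
      VectorField.mlieBracket_add_right hX hX']
    ring

theorem koszul_tensorial_right {X Y : Π x : M, TangentSpace I x} {x : M}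
    (hX : MDiffAt (T% X) x) (hY : MDiffAt (T% Y) x) :
    TensorialAt I E (fun Z ↦ koszul I X Y Z x) x where
  smul {f Z} hf hZ := by
    simp [koszul, inner_smul_left, inner_smul_right, mvfderiv_fun_mul hf (mdifferentiableAt_inner I hX hZ),
      mvfderiv_fun_mul hf (mdifferentiableAt_inner I hY hZ), VectorField.mlieBracket_smul_left hf hZ,
      VectorField.mlieBracket_smul_right hf hZ, inner_add_left, real_inner_comm]
    ring
  add {Z Z'} hZ hZ' := by
    simp [koszul, inner_add_left, inner_add_right,
      mvfderiv_fun_add (mdifferentiableAt_inner I hZ hX) (mdifferentiableAt_inner I hZ' hX),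
      mvfderiv_fun_add (mdifferentiableAt_inner I hY hZ) (mdifferentiableAt_inner I hY hZ'),
      VectorField.mlieBracket_add_left hZ hZ',
      VectorField.mlieBracket_add_right hZ hZ']
    ring

theorem koszul_add_mid {X Y Y' Z : Π x : M, TangentSpace I x} {x : M}
    (hX : MDiffAt (T% X) x) (hY : MDiffAt (T% Y) x) (hY' : MDiffAt (T% Y') x)
    (hZ : MDiffAt (T% Z) x) :
    koszul I X (Y + Y') Z x = koszul I X Y Z x + koszul I X Y' Z x := by
  simp [koszul, inner_add_left, inner_add_right,
      mvfderiv_fun_add (mdifferentiableAt_inner I hX hY) (mdifferentiableAt_inner I hX hY'),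
      mvfderiv_fun_add (mdifferentiableAt_inner I hY hZ) (mdifferentiableAt_inner I hY' hZ),
      VectorField.mlieBracket_add_left hY hY',
      VectorField.mlieBracket_add_right hY hY']
  ring

theorem koszul_smul_mid {X Y Z : Π x : M, TangentSpace I x} {f : M → ℝ} {x : M}
    (hX : MDiffAt (T% X) x) (hY : MDiffAt (T% Y) x) (hf : MDiffAt f x)
    (hZ : MDiffAt (T% Z) x) :
    koszul I X (f • Y) Z x =
      f x * koszul I X Y Z x + 2 * (mvfderiv I f x (X x) * inner ℝ (Y x) (Z x)) := by
  simp [koszul, inner_smul_left, inner_smul_right, mvfderiv_fun_mul hf (mdifferentiableAt_inner I hX hY),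
      mvfderiv_fun_mul hf (mdifferentiableAt_inner I hY hZ), VectorField.mlieBracket_smul_left hf hY,
      VectorField.mlieBracket_smul_right hf hY, inner_add_left, real_inner_comm]
  ring

variable [FiniteDimensional ℝ E]

open scoped Classical in
/-- For a vector field `Y` differentiable at `x`, the bilinear form `(v, w) ↦ ⟨∇_v Y, w⟩` on the
tangent space at `x`, given by the Koszul formula. -/
def koszulForm (Y : Π x : M, TangentSpace I x) (x : M) :
    TangentSpace I x →L[ℝ] TangentSpace I x →L[ℝ] ℝ :=
  if hY : MDiffAt (T% Y) x then
    (1 / 2 : ℝ) • TensorialAt.mkHom₂ (I := I) (F := E) (F' := E) (fun X Z ↦ koszul I X Y Z x) x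
      (fun _ hZ ↦ koszul_tensorial_left I hY hZ) (fun _ hX ↦ koszul_tensorial_right I hX hY)
  else 0

theorem koszulForm_apply {X Y Z : Π x : M, TangentSpace I x} {x : M}
    (hX : MDiffAt (T% X) x) (hY : MDiffAt (T% Y) x) (hZ : MDiffAt (T% Z) x) :
    koszulForm I Y x (X x) (Z x) = 1 / 2 * koszul I X Y Z x := by
  rw [koszulForm, dif_pos hY]
  simp only [smul_apply, smul_eq_mul]
  rw [TensorialAt.mkHom₂_apply (I := I) (F := E) (F' := E)
      (fun _ hZ ↦ koszul_tensorial_left I hY hZ) (fun _ hX ↦ koszul_tensorial_right I hX hY) hX hZ]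

/-- `∇ Y` at `x`, as an endomorphism of the tangent space: `∇_v Y` is the vector representing
the linear form `w ↦ ⟨∇_v Y, w⟩` of the Koszul formula. -/
def leviCivitaAux (Y : Π x : M, TangentSpace I x) (x : M) :
    TangentSpace I x →L[ℝ] TangentSpace I x :=
  LinearMap.toContinuousLinearMap
    { toFun := fun v ↦
        haveI : CompleteSpace (TangentSpace I x) := FiniteDimensional.complete ℝ _
        (InnerProductSpace.toDual ℝ (TangentSpace I x)).symm (koszulForm I Y x v)
      map_add' := by simp
      map_smul' := by simp }

theorem inner_leviCivitaAux (Y : Π x : M, TangentSpace I x) (x : M) (v w : TangentSpace I x) :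
    inner ℝ (leviCivitaAux I Y x v) w = koszulForm I Y x v w := by
  have : CompleteSpace (TangentSpace I x) := FiniteDimensional.complete ℝ _
  exact InnerProductSpace.toDual_symm_apply

/-- The Levi-Civita connection: `leviCivita I Y x v` is `∇_v Y` at `x`. -/
def leviCivita : CovariantDerivative I E (TangentSpace I : M → Type _) where
  toFun := leviCivitaAux I
  isCovariantDerivativeOnUniv :=
    { add := by
        intro Y Y' x hY hY' _
        ext v
        refine ext_inner_right ℝ fun w ↦ ?_
        have hv := FiberBundle.mdifferentiableAt_extend I E v
        have hw := FiberBundle.mdifferentiableAt_extend I E w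
        rw [add_apply, inner_add_left, inner_leviCivitaAux,
          inner_leviCivitaAux, inner_leviCivitaAux, ← FiberBundle.extend_apply_self E v,
          ← FiberBundle.extend_apply_self E w,
          koszulForm_apply I hv (mdifferentiableAt_add_section hY hY') hw,
          koszulForm_apply I hv hY hw, koszulForm_apply I hv hY' hw,
          koszul_add_mid I hv hY hY' hw]
        ring
      leibniz := by
        intro Y f x hY hf _
        ext v
        refine ext_inner_right ℝ fun w ↦ ?_
        have hv := FiberBundle.mdifferentiableAt_extend I E v
        have hw := FiberBundle.mdifferentiableAt_extend I E w
        have key := koszul_smul_mid I hv hY hf hw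
        have h1 := koszulForm_apply I hv (hf.smul_section hY) hw
        have h2 := koszulForm_apply I hv hY hw
        rw [FiberBundle.extend_apply_self, FiberBundle.extend_apply_self] at h1 h2 key
        rw [add_apply, smul_apply,
          ContinuousLinearMap.smulRight_apply, inner_add_left, inner_smul_left, inner_smul_left,
          inner_leviCivitaAux, inner_leviCivitaAux, h2]
        erw [h1]
        rw [key]
        simp
        ring }

theorem inner_leviCivita {X Y Z : Π x : M, TangentSpace I x} {x : M}
    (hX : MDiffAt (T% X) x) (hY : MDiffAt (T% Y) x) (hZ : MDiffAt (T% Z) x) :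
    inner ℝ (leviCivita I Y x (X x)) (Z x) = 1 / 2 * koszul I X Y Z x :=
  (inner_leviCivitaAux I Y x (X x) (Z x)).trans (koszulForm_apply I hX hY hZ)

/-- The Levi-Civita connection is torsion-free. -/
theorem leviCivita_torsion :
    (leviCivita I : CovariantDerivative I E (TangentSpace I : M → Type _)).torsion = 0 := by
  rw [CovariantDerivative.torsion_eq_zero_iff]
  intro X Y x hX hY
  refine ext_inner_right ℝ fun w ↦ ?_
  have hw := FiberBundle.mdifferentiableAt_extend I E w
  have h1 := inner_leviCivita I hX hY hw
  have h2 := inner_leviCivita I hY hX hw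
  rw [FiberBundle.extend_apply_self] at h1 h2
  rw [inner_sub_left, h1, h2]
  simp only [koszul, FiberBundle.extend_apply_self, real_inner_comm,
    VectorField.mlieBracket_swap_apply (V := Y) (W := X),
    VectorField.mlieBracket_swap_apply (V := X) (W := FiberBundle.extend E w),
    VectorField.mlieBracket_swap_apply (V := Y) (W := FiberBundle.extend E w),
    inner_neg_left]
  ring

/-- The Levi-Civita connection is compatible with the metric. -/
theorem leviCivita_metric {X Y Z : Π x : M, TangentSpace I x} {x : M}
    (hX : MDiffAt (T% X) x) (hY : MDiffAt (T% Y) x) (hZ : MDiffAt (T% Z) x) :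
    mvfderiv I (fun y ↦ inner ℝ (Y y) (Z y)) x (X x) =
      inner ℝ (leviCivita I Y x (X x)) (Z x) + inner ℝ (Y x) (leviCivita I Z x (X x)) := by
  rw [real_inner_comm _ (Y x), inner_leviCivita I hX hY hZ, inner_leviCivita I hX hZ hY]
  simp only [koszul, real_inner_comm,
    VectorField.mlieBracket_swap_apply (V := Y) (W := X),
    VectorField.mlieBracket_swap_apply (V := Z) (W := X),
    VectorField.mlieBracket_swap_apply (V := Z) (W := Y),
    inner_neg_left]
  ring

end LeviCivita
/-! ### Almost contact metric structures and cosymplectic manifolds -/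

section AlmostContact

variable {E : Type*} [NormedAddCommGroup E] [NormedSpace ℝ E]
  {H : Type*} [TopologicalSpace H] (I : ModelWithCorners ℝ E H)
  (M : Type*) [TopologicalSpace M] [ChartedSpace H M] [IsManifold I ∞ M]
  [RiemannianBundle (fun x : M ↦ TangentSpace I x)]

/-- An almost contact metric structure `(φ, ξ, η, g)` on the Riemannian manifold `(M, g)`:
a smooth `(1,1)`-tensor field `φ`, a smooth vector field `ξ` and a smooth `1`-form `η`. -/
structure AlmostContactMetricStructure where
  /-- The `(1,1)`-tensor field `φ`. -/
  phi : Π x : M, TangentSpace I x →L[ℝ] TangentSpace I x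
  /-- The characteristic vector field `ξ`. -/
  xi : Π x : M, TangentSpace I x
  /-- The `1`-form `η`. -/
  eta : Π x : M, TangentSpace I x →L[ℝ] ℝ
  contMDiff_phi : ContMDiff I (I.prod 𝓘(ℝ, E →L[ℝ] E)) ∞
    (fun x ↦ (⟨x, phi x⟩ :
      TotalSpace (E →L[ℝ] E) (fun x : M ↦ TangentSpace I x →L[ℝ] TangentSpace I x)))
  isSmoothField_xi : IsSmoothField I xi
  contMDiff_eta : ContMDiff I (I.prod 𝓘(ℝ, E →L[ℝ] ℝ)) ∞
    (fun x ↦ (⟨x, eta x⟩ : TotalSpace (E →L[ℝ] ℝ) (fun x : M ↦ TangentSpace I x →L[ℝ] ℝ)))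
  phi_phi : ∀ x v, phi x (phi x v) = -v + eta x v • xi x
  phi_xi : ∀ x, phi x (xi x) = 0
  eta_phi : ∀ x v, eta x (phi x v) = 0
  eta_xi : ∀ x, eta x (xi x) = 1
  inner_phi_phi : ∀ x v w, inner ℝ (phi x v) (phi x w) = inner ℝ v w - eta x v * eta x w
  eta_eq_inner : ∀ x v, eta x v = inner ℝ v (xi x)

namespace AlmostContactMetricStructure

variable {I M} (S : AlmostContactMetricStructure I M)

/-- The vector field `φ X`. -/
def phiField (X : Π x : M, TangentSpace I x) : Π x : M, TangentSpace I x :=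
  fun x ↦ S.phi x (X x)

/-- The fundamental `2`-form `Φ(X, Y) = g(X, φ Y)`. -/
def fundamentalForm (X Y : Π x : M, TangentSpace I x) (x : M) : ℝ :=
  inner ℝ (X x) (S.phi x (Y x))

/-- The exterior derivative of `η`, in the normalization
`2 dη(X, Y) = X η(Y) - Y η(X) - η([X, Y])`. -/
def dEta (X Y : Π x : M, TangentSpace I x) (x : M) : ℝ :=
  (1 / 2) * (mvfderiv I (fun y ↦ S.eta y (Y y)) x (X x)
    - mvfderiv I (fun y ↦ S.eta y (X y)) x (Y x)
    - S.eta x (VectorField.mlieBracket I X Y x))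

/-- The exterior derivative of `Φ`, in the normalization
`3 dΦ(X, Y, Z) = X Φ(Y, Z) + Y Φ(Z, X) + Z Φ(X, Y) - Φ([X, Y], Z) - Φ([Y, Z], X) - Φ([Z, X], Y)`. -/
def dFundamentalForm (X Y Z : Π x : M, TangentSpace I x) (x : M) : ℝ :=
  (1 / 3) * (mvfderiv I (S.fundamentalForm Y Z) x (X x)
    + mvfderiv I (S.fundamentalForm Z X) x (Y x)
    + mvfderiv I (S.fundamentalForm X Y) x (Z x)
    - S.fundamentalForm (VectorField.mlieBracket I X Y) Z x
    - S.fundamentalForm (VectorField.mlieBracket I Y Z) X x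
    - S.fundamentalForm (VectorField.mlieBracket I Z X) Y x)

/-- The Nijenhuis tensor
`[φ, φ](X, Y) = φ² [X, Y] + [φ X, φ Y] - φ [φ X, Y] - φ [X, φ Y]`. -/
def nijenhuis (X Y : Π x : M, TangentSpace I x) (x : M) : TangentSpace I x :=
  S.phi x (S.phi x (VectorField.mlieBracket I X Y x))
    + VectorField.mlieBracket I (S.phiField X) (S.phiField Y) x
    - S.phi x (VectorField.mlieBracket I (S.phiField X) Y x)
    - S.phi x (VectorField.mlieBracket I X (S.phiField Y) x)

/-- Normality: `[φ, φ] + 2 dη ⊗ ξ = 0`. -/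
def IsNormal : Prop :=
  ∀ X Y : Π x : M, TangentSpace I x, IsSmoothField I X → IsSmoothField I Y →
    ∀ x, S.nijenhuis X Y x + (2 * S.dEta X Y x) • S.xi x = 0

/-- A cosymplectic structure: a normal almost contact metric structure such that both `Φ` and `η`
are closed. -/
structure IsCosymplectic : Prop where
  isNormal : S.IsNormal
  closed_fundamentalForm : ∀ X Y Z : Π x : M, TangentSpace I x,
    IsSmoothField I X → IsSmoothField I Y → IsSmoothField I Z →
      ∀ x, S.dFundamentalForm X Y Z x = 0
  closed_eta : ∀ X Y : Π x : M, TangentSpace I x, IsSmoothField I X → IsSmoothField I Y →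
    ∀ x, S.dEta X Y x = 0

end AlmostContactMetricStructure

end AlmostContact

/-! ### Riemannian submersions, O'Neill's tensors, the second fundamental form of a map -/

section Submersion

variable {E : Type*} [NormedAddCommGroup E] [NormedSpace ℝ E] [FiniteDimensional ℝ E]
  {H : Type*} [TopologicalSpace H] (I : ModelWithCorners ℝ E H)
  {M : Type*} [TopologicalSpace M] [ChartedSpace H M] [IsManifold I ∞ M]
  {E' : Type*} [NormedAddCommGroup E'] [NormedSpace ℝ E']
  {H' : Type*} [TopologicalSpace H'] (J : ModelWithCorners ℝ E' H')
  {N : Type*} [TopologicalSpace N] [ChartedSpace H' N] [IsManifold J ∞ N]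
  (F : M → N)

/-- The vertical space `ker F_*` at `x`. -/
def verticalSpace (x : M) : Submodule ℝ (TangentSpace I x) :=
  (mfderiv I J F x).ker

variable [RiemannianBundle (fun x : M ↦ TangentSpace I x)]

/-- The horizontal space `(ker F_*)ᗮ` at `x`. -/
def horizontalSpace (x : M) : Submodule ℝ (TangentSpace I x) :=
  (verticalSpace I J F x)ᗮ

instance (x : M) : (horizontalSpace I J F x).HasOrthogonalProjection :=
  inferInstanceAs (verticalSpace I J F x)ᗮ.HasOrthogonalProjection

/-- `V ∈ Γ(ker F_*)`. -/
structure IsVerticalField (V : Π x : M, TangentSpace I x) : Prop where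
  smooth : IsSmoothField I V
  mem : ∀ x, V x ∈ verticalSpace I J F x

/-- `X ∈ Γ((ker F_*)ᗮ)`. -/
structure IsHorizontalField (X : Π x : M, TangentSpace I x) : Prop where
  smooth : IsSmoothField I X
  mem : ∀ x, X x ∈ horizontalSpace I J F x

/-- The vertical part `𝒱 X` of a vector field. -/
def verticalPart (X : Π x : M, TangentSpace I x) : Π x : M, TangentSpace I x :=
  fun x ↦ (verticalSpace I J F x).starProjection (X x)

/-- The horizontal part `ℋ X` of a vector field. -/
def horizontalPart (X : Π x : M, TangentSpace I x) : Π x : M, TangentSpace I x :=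
  fun x ↦ (horizontalSpace I J F x).starProjection (X x)

/-- A Riemannian submersion: a smooth surjective map whose differential is everywhere onto and
preserves the lengths of horizontal vectors. -/
structure IsRiemannianSubmersion [RiemannianBundle (fun y : N ↦ TangentSpace J y)] : Prop where
  contMDiff : ContMDiff I J ∞ F
  surjective : Function.Surjective F
  surjective_mfderiv : ∀ x, Function.Surjective (mfderiv I J F x)
  norm_mfderiv : ∀ x, ∀ v ∈ horizontalSpace I J F x, ‖mfderiv I J F x v‖ = ‖v‖

section ONeill

variable [CompleteSpace E] [IsContMDiffRiemannianBundle I ∞ E (fun x : M ↦ TangentSpace I x)]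

/-- The vector field `∇_X Y`. -/
def nabla (X Y : Π x : M, TangentSpace I x) : Π x : M, TangentSpace I x :=
  fun x ↦ leviCivita I Y x (X x)

/-- O'Neill's tensor `T_X Y = ℋ ∇_{𝒱 X} 𝒱 Y + 𝒱 ∇_{𝒱 X} ℋ Y`. -/
def oneillT (X Y : Π x : M, TangentSpace I x) : Π x : M, TangentSpace I x :=
  horizontalPart I J F (nabla I (verticalPart I J F X) (verticalPart I J F Y))
    + verticalPart I J F (nabla I (verticalPart I J F X) (horizontalPart I J F Y))

/-- O'Neill's tensor `A_X Y = 𝒱 ∇_{ℋ X} ℋ Y + ℋ ∇_{ℋ X} 𝒱 Y`. -/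
def oneillA (X Y : Π x : M, TangentSpace I x) : Π x : M, TangentSpace I x :=
  verticalPart I J F (nabla I (horizontalPart I J F X) (horizontalPart I J F Y))
    + horizontalPart I J F (nabla I (horizontalPart I J F X) (verticalPart I J F Y))

end ONeill

/-- An anti-invariant Riemannian submersion: `φ (ker F_*) ⊆ (ker F_*)ᗮ`. -/
structure IsAntiInvariantRiemannianSubmersion
    [RiemannianBundle (fun y : N ↦ TangentSpace J y)]
    (S : AlmostContactMetricStructure I M) : Prop where
  isRiemannianSubmersion : IsRiemannianSubmersion I J F
  map_phi_le : ∀ x, ∀ v ∈ verticalSpace I J F x, S.phi x v ∈ horizontalSpace I J F x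

end Submersion

section SecondFundamentalForm

variable {E : Type*} [NormedAddCommGroup E] [NormedSpace ℝ E]
  {H : Type*} [TopologicalSpace H] (I : ModelWithCorners ℝ E H)
  {M : Type*} [TopologicalSpace M] [ChartedSpace H M]
  {E' : Type*} [NormedAddCommGroup E'] [NormedSpace ℝ E'] [FiniteDimensional ℝ E']
  [CompleteSpace E']
  {H' : Type*} [TopologicalSpace H'] (J : ModelWithCorners ℝ E' H')
  {N : Type*} [TopologicalSpace N] [ChartedSpace H' N] [IsManifold J ∞ N]
  [RiemannianBundle (fun y : N ↦ TangentSpace J y)]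
  [IsContMDiffRiemannianBundle J ∞ E' (fun y : N ↦ TangentSpace J y)]
  (F : M → N)

/-- The pullback to `F⁻¹ TN` of the Levi-Civita connection of `N`: the derivative `∇^F_v s` at `p`
of a section `s` of `F⁻¹ TN`. In a local frame `e₁, …, eₙ` of `TN` around `F p`, with
`s = ∑ sⁱ (eᵢ ∘ F)` near `p`, it is `∑ (dsⁱ(v) eᵢ(F p) + sⁱ(p) ∇_{F_* v} eᵢ)`. Here the frame is
the one of the chart at `F p`, and `∑ sⁱ(p) eᵢ` is the extension `FiberBundle.extend E' (s p)`
of `s p` with constant coefficients. -/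
def pullbackNabla (s : Π q : M, TangentSpace J (F q)) (p : M) (v : TangentSpace I p) :
    TangentSpace J (F p) :=
  let e := trivializationAt E' (TangentSpace J : N → Type _) (F p)
  e.symmL ℝ (F p)
      (mvfderiv I (fun q ↦ (e (⟨F q, s q⟩ : TotalSpace E' (TangentSpace J : N → Type _))).2) p v)
    + leviCivita J (FiberBundle.extend E' (s p)) (F p) (mfderiv I J F p v)

/-- The derivative `∇^F` of a vector field along `F` of the form `Y ∘ F` is `∇_{F_* v} Y`. -/
theorem pullbackNabla_comp {Y : Π y : N, TangentSpace J y} {p : M} (hF : MDiffAt F p)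
    (hY : MDiffAt (T% Y) (F p)) (v : TangentSpace I p) :
    pullbackNabla I J F (fun q ↦ Y (F q)) p v = leviCivita J Y (F p) (mfderiv I J F p v) := by
  let e := trivializationAt E' (TangentSpace J : N → Type _) (F p)
  have hmem : F p ∈ e.baseSet := FiberBundle.mem_baseSet_trivializationAt' (F p)
  let w : TangentSpace J (F p) := mfderiv I J F p v
  let c : (Π y : N, TangentSpace J y) → N → E' := fun Z y ↦
    (e (⟨y, Z y⟩ : TotalSpace E' (TangentSpace J : N → Type _))).2
  have hc : ∀ Z : Π y : N, TangentSpace J y, MDiffAt (T% Z) (F p) → MDiffAt (c Z) (F p) :=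
    fun Z hZ ↦ (mdifferentiableAt_section J Z).1 hZ
  have hnear : ∀ᶠ y in 𝓝 (F p), y ∈ e.baseSet := e.open_baseSet.mem_nhds hmem
  have htens : TensorialAt J E' (fun Z : Π y : N, TangentSpace J y ↦
      leviCivita J Z (F p) w - e.symmL ℝ (F p) (mvfderiv J (c Z) (F p) w)) (F p) := by
    constructor
    · intro f Z hf hZ
      have h1 : c (f • Z) =ᶠ[𝓝 (F p)] f • c Z := by
        filter_upwards [hnear] with y hy
        exact (e.linear ℝ hy).map_smul (f y) (Z y)
      have h2 : e.symmL ℝ (F p) (c Z (F p)) = Z (F p) := by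
        rw [e.symmL_apply hmem]
        exact e.symm_apply_apply_mk hmem (Z (F p))
      have h3 : mvfderiv J (c (f • Z)) (F p) = mvfderiv J (f • c Z) (F p) := by
        ext u
        simp only [mvfderiv, h1.mfderiv_eq, ContinuousLinearMap.comp_apply]
        rfl
      rw [h3, mvfderiv_smul hf (hc Z hZ),
        (leviCivita J).isCovariantDerivativeOnUniv.leibniz hZ hf]
      simp [h2, smul_sub]
    · intro Z Z' hZ hZ'
      have h1 : c (Z + Z') =ᶠ[𝓝 (F p)] c Z + c Z' := by
        filter_upwards [hnear] with y hy
        exact (e.linear ℝ hy).map_add (Z y) (Z' y)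
      have h3 : mvfderiv J (c (Z + Z')) (F p) = mvfderiv J (c Z + c Z') (F p) := by
        ext u
        simp only [mvfderiv, h1.mfderiv_eq, ContinuousLinearMap.comp_apply]
        rfl
      rw [h3, mvfderiv_add (hc Z hZ) (hc Z' hZ'),
        (leviCivita J).isCovariantDerivativeOnUniv.add hZ hZ']
      simp only [add_apply, map_add]
      abel
  have h := htens.pointwise hY (FiberBundle.mdifferentiableAt_extend J E' (Y (F p)))
    (FiberBundle.extend_apply_self E' (Y (F p))).symm
  have h0 : c (FiberBundle.extend E' (Y (F p))) =ᶠ[𝓝 (F p)]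
      fun _ ↦ (e (⟨F p, Y (F p)⟩ : TotalSpace E' (TangentSpace J : N → Type _))).2 := by
    filter_upwards [hnear] with y hy
    have h1 := congrArg Prod.snd
      (e.apply_mk_symm hy (e (⟨F p, Y (F p)⟩ : TotalSpace E' (TangentSpace J : N → Type _))).2)
    exact h1
  have h4 : mvfderiv J (c (FiberBundle.extend E' (Y (F p)))) (F p) = 0 := by
    rw [mvfderiv, h0.mfderiv_eq, mfderiv_const]
    exact ContinuousLinearMap.comp_zero _
  have h5 : mvfderiv I (fun q ↦ c Y (F q)) p v = mvfderiv J (c Y) (F p) w := by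
    have := mfderiv_comp_apply p (hc Y hY) hF v
    exact this
  rw [h4] at h
  simp only [zero_apply, map_zero, sub_zero] at h
  rw [sub_eq_iff_eq_add] at h
  change e.symmL ℝ (F p) (mvfderiv I (fun q ↦ c Y (F q)) p v) + leviCivita J _ (F p) w
    = leviCivita J Y (F p) w
  rw [h, h5, add_comm]

variable [IsManifold I ∞ M] [RiemannianBundle (fun x : M ↦ TangentSpace I x)]
  [FiniteDimensional ℝ E] [CompleteSpace E]
  [IsContMDiffRiemannianBundle I ∞ E (fun x : M ↦ TangentSpace I x)]

/-- The second fundamental form `(∇F_*)(X, Y) = ∇^F_X (F_* Y) - F_* (∇_X Y)`. -/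
def secondFundamentalForm (X Y : Π x : M, TangentSpace I x) (p : M) : TangentSpace J (F p) :=
  pullbackNabla I J F (fun q ↦ mfderiv I J F q (Y q)) p (X p)
    - mfderiv I J F p (nabla I X Y p)

/-- `F` is a totally geodesic map: `∇F_* = 0`. -/
def IsTotallyGeodesicMap : Prop :=
  ∀ X Y : Π x : M, TangentSpace I x, IsSmoothField I X → IsSmoothField I Y →
    ∀ p, secondFundamentalForm I J F X Y p = 0

end SecondFundamentalForm
end RiemGeom
end

/-!
The second fundamental form `(∇F_*)(X, Y)` is tensorial in `Y`, so it may be computed on convenient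
fields. If `Y` is vertical, then `F_* Y = 0` and `(∇F_*)(X, Y) = -F_* (∇_X Y)`; if `Y` is basic and
`X` horizontal, then it vanishes, since the Koszul formula for basic fields reduces to that of `N`;
if `Y` is basic and `X = V` is vertical, then `[V, Y]` is vertical and `F_* (∇_V Y) = F_* (∇_Y V)`.
Hence `F` is totally geodesic if and only if the vertical distribution is parallel.

For `V` vertical and `Z` horizontal, differentiating `g(V, Z) = 0` gives
`g(V, ∇_v Z) = -g(∇_v V, Z)`. As the values `φ U` of vertical fields `U` exhaust the horizontal
distribution, the vertical distribution is parallel if and only if `∇_v (φ U)` is always horizontal.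
The vertical part of `∇_v (φ U)` is `T_v (φ U)` for `v` vertical and `A_v (φ U)` for `v` horizontal.
-/

noncomputable section

namespace RiemGeom

section RelatedVectorFields

open Set VectorField

variable {𝕜 : Type*} [NontriviallyNormedField 𝕜]
  {E : Type*} [NormedAddCommGroup E] [NormedSpace 𝕜 E]
  {E' : Type*} [NormedAddCommGroup E'] [NormedSpace 𝕜 E']

theorem fderivWithin_fderivWithin_apply_of_related {f : E → E'} {s : Set E} {t : Set E'} {x : E}
    {V W : E → E} {V' W' : E' → E'} (hf : DifferentiableWithinAt 𝕜 f s x) (hst : MapsTo f s t)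
    (hs : UniqueDiffWithinAt 𝕜 s x) (hx : x ∈ s) (hV' : DifferentiableWithinAt 𝕜 V' t (f x))
    (hVV' : (fun y ↦ fderivWithin 𝕜 f s y (V y)) =ᶠ[𝓝[s] x] V' ∘ f)
    (hWW' : fderivWithin 𝕜 f s x (W x) = W' (f x)) :
    fderivWithin 𝕜 (fun y ↦ fderivWithin 𝕜 f s y (V y)) s x (W x) =
      fderivWithin 𝕜 V' t (f x) (W' (f x)) := by
  rw [hVV'.fderivWithin_eq_of_mem hx, fderivWithin_comp x hV' hf hst hs,
    ContinuousLinearMap.comp_apply, hWW']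

theorem fderivWithin_lieBracketWithin_of_related {f : E → E'} {s : Set E} {t : Set E'} {x : E}
    {n : ℕ∞ω} {V W : E → E} {V' W' : E' → E'} (hf : ContDiffWithinAt 𝕜 n f s x)
    (hn : minSmoothness 𝕜 2 ≤ n) (hst : MapsTo f s t) (hs : UniqueDiffOn 𝕜 s)
    (hxs : x ∈ closure (interior s)) (hx : x ∈ s)
    (hV : DifferentiableWithinAt 𝕜 V s x) (hW : DifferentiableWithinAt 𝕜 W s x)
    (hV' : DifferentiableWithinAt 𝕜 V' t (f x)) (hW' : DifferentiableWithinAt 𝕜 W' t (f x))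
    (hVV' : (fun y ↦ fderivWithin 𝕜 f s y (V y)) =ᶠ[𝓝[s] x] V' ∘ f)
    (hWW' : (fun y ↦ fderivWithin 𝕜 f s y (W y)) =ᶠ[𝓝[s] x] W' ∘ f) :
    fderivWithin 𝕜 f s x (lieBracketWithin 𝕜 V W s x) = lieBracketWithin 𝕜 V' W' t (f x) := by
  have hfd : DifferentiableWithinAt 𝕜 f s x :=
    hf.differentiableWithinAt (two_pos.trans_le (le_minSmoothness.trans hn)).ne'
  rw [fderivWithin_apply_lieBracket hf hn hs hxs hx hW hV,
    fderivWithin_fderivWithin_apply_of_related hfd hst (hs x hx) hx hW' hWW'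
      (hVV'.self_of_nhdsWithin hx),
    fderivWithin_fderivWithin_apply_of_related hfd hst (hs x hx) hx hV' hVV'
      (hWW'.self_of_nhdsWithin hx)]
  rfl

variable {H : Type*} [TopologicalSpace H] {I : ModelWithCorners 𝕜 E H}
  {M : Type*} [TopologicalSpace M] [ChartedSpace H M]

theorem mpullbackWithin_extChartAt_symm_apply [IsManifold I 1 M] {p q : M}
    (hq : q ∈ (extChartAt I p).source) (V : Π x : M, TangentSpace I x) :
    mpullbackWithin 𝓘(𝕜, E) I (extChartAt I p).symm V (range I) (extChartAt I p q) =
      mfderiv I 𝓘(𝕜, E) (extChartAt I p) q (V q) := by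
  have hinv := isInvertible_mfderivWithin_extChartAt_symm ((extChartAt I p).map_source hq)
  rw [(extChartAt I p).left_inv hq] at hinv
  rw [mpullbackWithin_apply, (extChartAt I p).left_inv hq, hinv.inverse_apply_eq]
  exact (DFunLike.congr_fun
    (mfderivWithin_extChartAt_symm_comp_mfderiv_extChartAt' hq) (V q)).symm

theorem mlieBracket_eq_lieBracketWithin_mpullbackWithin [IsManifold I 1 M]
    (V W : Π x : M, TangentSpace I x) (p : M) :
    mlieBracket I V W p = lieBracketWithin 𝕜
      (mpullbackWithin 𝓘(𝕜, E) I (extChartAt I p).symm V (range I))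
      (mpullbackWithin 𝓘(𝕜, E) I (extChartAt I p).symm W (range I)) (range I)
      (extChartAt I p p) := by
  rw [← mlieBracketWithin_univ, mlieBracketWithin_apply, mfderiv_extChartAt_self, preimage_univ,
    univ_inter]
  exact DFunLike.congr_fun (ContinuousLinearMap.inverse_id (R := 𝕜) (M := E)) _

variable {H' : Type*} [TopologicalSpace H'] {J : ModelWithCorners 𝕜 E' H'}
  {N : Type*} [TopologicalSpace N] [ChartedSpace H' N]

theorem fderivWithin_writtenInExtChartAt_mpullbackWithin [IsManifold I 1 M] [IsManifold J 1 N]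
    {F : M → N} {p : M} {y : E} (hy : y ∈ (extChartAt I p).target)
    (hF : MDifferentiableAt I J F ((extChartAt I p).symm y))
    (hFy : F ((extChartAt I p).symm y) ∈ (extChartAt J (F p)).source)
    (V : Π x : M, TangentSpace I x) :
    fderivWithin 𝕜 (writtenInExtChartAt I J p F) (range I) y
        (mpullbackWithin 𝓘(𝕜, E) I (extChartAt I p).symm V (range I) y) =
      mfderiv J 𝓘(𝕜, E') (extChartAt J (F p)) (F ((extChartAt I p).symm y))
        (mfderiv I J F ((extChartAt I p).symm y) (V ((extChartAt I p).symm y))) := by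
  have hψ : MDifferentiableAt J 𝓘(𝕜, E') (extChartAt J (F p)) (F ((extChartAt I p).symm y)) :=
    mdifferentiableAt_extChartAt (by rwa [extChartAt_source] at hFy)
  have hchain := mfderiv_comp_mfderivWithin y (hψ.comp _ hF)
    (mdifferentiableWithinAt_extChartAt_symm hy)
    (I.uniqueMDiffOn y (extChartAt_target_subset_range p hy))
  rw [writtenInExtChartAt, ← mfderivWithin_eq_fderivWithin]
  refine (DFunLike.congr_fun hchain _).trans ?_
  rw [ContinuousLinearMap.comp_apply, mpullbackWithin_apply,
    (isInvertible_mfderivWithin_extChartAt_symm hy).self_apply_inverse]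
  exact mfderiv_comp_apply _ hψ hF _

theorem fderivWithin_writtenInExtChartAt_mpullbackWithin_eventuallyEq [IsManifold I 1 M]
    [IsManifold J 1 N] {F : M → N} {p : M} (hF : ∀ᶠ q in 𝓝 p, MDifferentiableAt I J F q)
    {V : Π x : M, TangentSpace I x} {V' : Π y : N, TangentSpace J y}
    (hVV' : ∀ᶠ q in 𝓝 p, mfderiv I J F q (V q) = V' (F q)) :
    (fun y ↦ fderivWithin 𝕜 (writtenInExtChartAt I J p F) (range I) y
        (mpullbackWithin 𝓘(𝕜, E) I (extChartAt I p).symm V (range I) y))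
      =ᶠ[𝓝[range I] extChartAt I p p]
        mpullbackWithin 𝓘(𝕜, E') J (extChartAt J (F p)).symm V' (range J) ∘
          writtenInExtChartAt I J p F := by
  have htendsto := (map_extChartAt_symm_nhdsWithin_range (I := I) p).le
  have hsource := hF.self_of_nhds.continuousAt.eventually_mem
    (extChartAt_source_mem_nhds (I := J) (F p))
  filter_upwards [extChartAt_target_mem_nhdsWithin p, htendsto (hF.and (hsource.and hVV'))]
    with y hy ⟨hFy, hy', hVy⟩
  rw [fderivWithin_writtenInExtChartAt_mpullbackWithin hy hFy hy', hVy]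
  exact (mpullbackWithin_extChartAt_symm_apply hy' V').symm

theorem differentiableWithinAt_mpullbackWithin_extChartAt_symm [CompleteSpace E] [IsManifold I 2 M]
    {V : Π x : M, TangentSpace I x} {p : M} (hV : MDiffAt (T% V) p) :
    DifferentiableWithinAt 𝕜 (F := E) (mpullbackWithin 𝓘(𝕜, E) I (extChartAt I p).symm V (range I))
      (range I) (extChartAt I p p) := by
  have h := (hV.mdifferentiableWithinAt
    (s := univ)).differentiableWithinAt_mpullbackWithin_vectorField
  rwa [preimage_univ, univ_inter] at h

theorem mfderiv_mlieBracket_of_related [CompleteSpace E] [CompleteSpace E']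
    [IsManifold I 1 M] [IsManifold J 1 N] {n : ℕ∞ω} [IsManifold I n M] [IsManifold J n N]
    {F : M → N} {p : M} (hF : ContMDiffAt I J n F p) (hn : minSmoothness 𝕜 2 ≤ n)
    {V W : Π x : M, TangentSpace I x} {V' W' : Π y : N, TangentSpace J y}
    (hV : MDiffAt (T% V) p) (hW : MDiffAt (T% W) p)
    (hV' : MDiffAt (T% V') (F p)) (hW' : MDiffAt (T% W') (F p))
    (hVV' : ∀ᶠ q in 𝓝 p, mfderiv I J F q (V q) = V' (F q))
    (hWW' : ∀ᶠ q in 𝓝 p, mfderiv I J F q (W q) = W' (F q)) :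
    mfderiv I J F p (mlieBracket I V W p) = mlieBracket J V' W' (F p) := by
  have hn2 : 2 ≤ n := le_minSmoothness.trans hn
  have : IsManifold I 2 M := .of_le hn2
  have : IsManifold J 2 N := .of_le hn2
  have hFd : ∀ᶠ q in 𝓝 p, MDifferentiableAt I J F q :=
    ((contMDiffAt_iff_contMDiffAt_nhds (by simp)).1
      (hF.of_le (one_le_two.trans hn2))).mono fun _ h ↦ h.mdifferentiableAt one_ne_zero
  have hFp : extChartAt J (F p) (F p) = writtenInExtChartAt I J p F (extChartAt I p p) := by
    simp [writtenInExtChartAt]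
  rw [hFd.self_of_nhds.mfderiv, mlieBracket_eq_lieBracketWithin_mpullbackWithin,
    mlieBracket_eq_lieBracketWithin_mpullbackWithin, hFp]
  exact fderivWithin_lieBracketWithin_of_related (E := E) (E' := E') (contMDiffAt_iff.1 hF).2 hn
    (fun _ _ ↦ mem_range_self _) I.uniqueDiffOn
    (I.range_subset_closure_interior (mem_range_self _)) (mem_range_self _)
    (differentiableWithinAt_mpullbackWithin_extChartAt_symm hV)
    (differentiableWithinAt_mpullbackWithin_extChartAt_symm hW)
    (hFp ▸ differentiableWithinAt_mpullbackWithin_extChartAt_symm hV')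
    (hFp ▸ differentiableWithinAt_mpullbackWithin_extChartAt_symm hW')
    (fderivWithin_writtenInExtChartAt_mpullbackWithin_eventuallyEq hFd hVV')
    (fderivWithin_writtenInExtChartAt_mpullbackWithin_eventuallyEq hFd hWW')

end RelatedVectorFields

section GramSchmidt

open InnerProductSpace

variable {V : Type*} [NormedAddCommGroup V] [InnerProductSpace ℝ V]
  {ι : Type*} [LinearOrder ι] [LocallyFiniteOrderBot ι] [WellFoundedLT ι]

theorem gramSchmidt_eq_sub_sum (s : ι → V) (i : ι) :
    gramSchmidt ℝ s i = s i - ∑ j ∈ Finset.Iio i,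
      ((inner ℝ (gramSchmidt ℝ s j) (s i) : ℝ) /
        inner ℝ (gramSchmidt ℝ s j) (gramSchmidt ℝ s j)) • gramSchmidt ℝ s j := by
  rw [gramSchmidt_def]
  simp only [Submodule.starProjection_singleton, real_inner_self_eq_norm_sq]
  rfl

theorem eq_sum_gramSchmidt_smul [Fintype ι] (b : Module.Basis ι ℝ V) (v : V) :
    v = ∑ i, ((inner ℝ (gramSchmidt ℝ b i) v : ℝ) /
      inner ℝ (gramSchmidt ℝ b i) (gramSchmidt ℝ b i)) • gramSchmidt ℝ b i := by
  refine ext_inner_left_basis (gramSchmidtBasis b) fun j ↦ ?_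
  rw [coe_gramSchmidtBasis, inner_sum, Finset.sum_eq_single j]
  · rw [inner_smul_right, div_mul_cancel₀]
    exact inner_self_ne_zero.2 (gramSchmidt_ne_zero j b.linearIndependent)
  · intro i _ hij
    rw [inner_smul_right, gramSchmidt_orthogonal ℝ b hij.symm, mul_zero]
  · simp

end GramSchmidt

section SmoothSections

open InnerProductSpace

variable {EB : Type*} [NormedAddCommGroup EB] [NormedSpace ℝ EB]
  {HB : Type*} [TopologicalSpace HB] {IB : ModelWithCorners ℝ EB HB} {n : ℕ∞ω}
  {B : Type*} [TopologicalSpace B] [ChartedSpace HB B]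
  {F : Type*} [NormedAddCommGroup F] [NormedSpace ℝ F]
  {E : B → Type*} [TopologicalSpace (TotalSpace F E)]

section Extension

variable [∀ x, AddCommGroup (E x)] [∀ x, Module ℝ (E x)] [∀ x, TopologicalSpace (E x)]
  [FiberBundle F E] [VectorBundle ℝ F E]

theorem exists_contMDiff_section_eq [FiniteDimensional ℝ EB] [T2Space B] [IsManifold IB ∞ B]
    [∀ x, IsTopologicalAddGroup (E x)] [∀ x, ContinuousSMul ℝ (E x)]
    [ContMDiffVectorBundle ∞ F E IB] {p : B} (v : E p) :
    ∃ s : Π x, E x, ContMDiff IB (IB.prod 𝓘(ℝ, F)) ∞ (T% s) ∧ s p = v := by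
  obtain ⟨u, hu, hsmooth⟩ := FiberBundle.exists_contMDiffOn_extend (k := ∞) IB F v
  obtain ⟨f, hf⟩ := (SmoothBumpFunction.nhds_basis_support (I := IB)
    (interior_mem_nhds.2 hu)).ex_mem
  exact ⟨(f : B → ℝ) • FiberBundle.extend F v,
    ContMDiffOn.smul_section_of_tsupport f.contMDiff.contMDiffOn isOpen_interior hf
      (hsmooth.mono interior_subset), by simp⟩

end Extension

section Riemannian

variable [∀ x, NormedAddCommGroup (E x)] [∀ x, InnerProductSpace ℝ (E x)]
  [FiberBundle F E] [VectorBundle ℝ F E]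
  [IsContMDiffRiemannianBundle IB n F E]

theorem contMDiffAt_gramSchmidt {ι : Type*} [LinearOrder ι] [LocallyFiniteOrderBot ι]
    [WellFoundedLT ι] {s : ι → Π x : B, E x} {p : B}
    (hs : ∀ i, ContMDiffAt IB (IB.prod 𝓘(ℝ, F)) n (T% (s i)) p)
    (hli : LinearIndependent ℝ fun i ↦ s i p) (i : ι) :
    ContMDiffAt IB (IB.prod 𝓘(ℝ, F)) n (T% (fun x ↦ gramSchmidt ℝ (fun i ↦ s i x) i)) p := by
  induction i using WellFoundedLT.induction with
  | ind i ih =>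
    simp only [gramSchmidt_eq_sub_sum _ i]
    refine (hs i).sub_section (ContMDiffAt.sum_section fun j hj ↦ ?_)
    have hj' := ih j (Finset.mem_Iio.1 hj)
    exact ((hj'.inner_bundle (hs i)).div₀ (hj'.inner_bundle hj')
      (inner_self_ne_zero.2 (gramSchmidt_ne_zero j hli))).smul_section hj'

-- In the orthogonal frame produced by Gram-Schmidt, the coefficients of `Y` are quotients of inner
-- products.
theorem contMDiffAt_of_contMDiffAt_inner [FiniteDimensional ℝ F]
    [ContMDiffVectorBundle n F E IB] {Y : Π x : B, E x} {p : B}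
    (h : ∀ Z : Π x : B, E x, ContMDiffAt IB (IB.prod 𝓘(ℝ, F)) n (T% Z) p →
      ContMDiffAt IB 𝓘(ℝ) n (fun x ↦ (inner ℝ (Z x) (Y x) : ℝ)) p) :
    ContMDiffAt IB (IB.prod 𝓘(ℝ, F)) n (T% Y) p := by
  let e := trivializationAt F E p
  let b := Module.finBasis ℝ F
  have hp : p ∈ e.baseSet := FiberBundle.mem_baseSet_trivializationAt' p
  have hs := e.isLocalFrameOn_localFrame_baseSet IB n b
  let g i x := gramSchmidt ℝ (fun i ↦ e.localFrame b i x) i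
  have hg i : ContMDiffAt IB (IB.prod 𝓘(ℝ, F)) n (T% (g i)) p :=
    contMDiffAt_gramSchmidt (fun i ↦ hs.contMDiffAt e.open_baseSet hp i)
      (hs.linearIndependent hp) i
  have hsum : ∀ᶠ x in 𝓝 p,
      Y x = ∑ i, ((inner ℝ (g i x) (Y x) : ℝ) / inner ℝ (g i x) (g i x)) • g i x := by
    filter_upwards [e.open_baseSet.mem_nhds hp] with x hx
    have := eq_sum_gramSchmidt_smul (hs.toBasisAt hx) (Y x)
    rwa [funext (hs.toBasisAt_coe hx)] at this
  refine ContMDiffAt.congr_of_eventuallyEq (ContMDiffAt.sum_section fun i _ ↦ ?_)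
    (hsum.mono fun x hx ↦ congrArg (TotalSpace.mk x) hx)
  exact ((h _ (hg i)).div₀ ((hg i).inner_bundle (hg i))
    (inner_self_ne_zero.2 (gramSchmidt_ne_zero i (hs.linearIndependent hp)))).smul_section (hg i)

end Riemannian

end SmoothSections

section DifferentialOfFields

variable {𝕜 : Type*} [NontriviallyNormedField 𝕜]
  {E : Type*} [NormedAddCommGroup E] [NormedSpace 𝕜 E]
  {H : Type*} [TopologicalSpace H] {I : ModelWithCorners 𝕜 E H}
  {M : Type*} [TopologicalSpace M] [ChartedSpace H M] [IsManifold I 1 M]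
  {E' : Type*} [NormedAddCommGroup E'] [NormedSpace 𝕜 E']
  {H' : Type*} [TopologicalSpace H'] {J : ModelWithCorners 𝕜 E' H'}
  {N : Type*} [TopologicalSpace N] [ChartedSpace H' N] [IsManifold J 1 N]
  {F : M → N} {m n : ℕ∞ω} {X : Π x : M, TangentSpace I x} {p : M}

theorem contMDiffAt_mfderiv_apply (hF : ContMDiff I J n F) (hmn : m + 1 ≤ n)
    (hX : CMDiffAt m (T% X) p) :
    ContMDiffAt I J.tangent m (fun q ↦ (⟨F q, mfderiv I J F q (X q)⟩ : TangentBundle J N)) p :=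
  (hF.contMDiff_tangentMap hmn).contMDiffAt.comp p hX

theorem mdifferentiableAt_mfderiv_apply (hF : ContMDiff I J n F) (hn : 2 ≤ n)
    (hX : MDiffAt (T% X) p) :
    MDifferentiableAt I J.tangent
      (fun q ↦ (⟨F q, mfderiv I J F q (X q)⟩ : TangentBundle J N)) p :=
  ((hF.contMDiff_tangentMap (m := 1) (by rwa [one_add_one_eq_two])).mdifferentiableAt
    one_ne_zero).comp p hX

end DifferentialOfFields

section HorizontalLift

variable {E : Type*} [NormedAddCommGroup E] [NormedSpace ℝ E]
  {H : Type*} [TopologicalSpace H] {I : ModelWithCorners ℝ E H}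
  {M : Type*} [TopologicalSpace M] [ChartedSpace H M]
  {E' : Type*} [NormedAddCommGroup E'] [NormedSpace ℝ E']
  {H' : Type*} [TopologicalSpace H'] {J : ModelWithCorners ℝ E' H'}
  {N : Type*} [TopologicalSpace N] [ChartedSpace H' N]
  {F : M → N}

theorem mem_verticalSpace {x : M} {v : TangentSpace I x} :
    v ∈ verticalSpace I J F x ↔ mfderiv I J F x v = 0 :=
  Iff.rfl

variable [RiemannianBundle (fun x : M ↦ TangentSpace I x)]

theorem IsRiemannianSubmersion.inner_mfderiv [RiemannianBundle (fun y : N ↦ TangentSpace J y)]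
    (hF : IsRiemannianSubmersion I J F) {x : M} {v w : TangentSpace I x}
    (hv : v ∈ horizontalSpace I J F x) (hw : w ∈ horizontalSpace I J F x) :
    inner ℝ (mfderiv I J F x v) (mfderiv I J F x w) = inner ℝ v w := by
  rw [real_inner_eq_norm_mul_self_add_norm_mul_self_sub_norm_sub_mul_self_div_two,
    real_inner_eq_norm_mul_self_add_norm_mul_self_sub_norm_sub_mul_self_div_two,
    ← map_sub, hF.norm_mfderiv x _ hv, hF.norm_mfderiv x _ hw,
    hF.norm_mfderiv x _ (Submodule.sub_mem _ hv hw)]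

variable [FiniteDimensional ℝ E]

theorem starProjection_verticalSpace_add_starProjection_horizontalSpace {x : M}
    (v : TangentSpace I x) :
    (verticalSpace I J F x).starProjection v + (horizontalSpace I J F x).starProjection v = v :=
  Submodule.starProjection_add_starProjection_orthogonal (K := verticalSpace I J F x) v

theorem mfderiv_starProjection_horizontalSpace {x : M} (v : TangentSpace I x) :
    mfderiv I J F x ((horizontalSpace I J F x).starProjection v) = mfderiv I J F x v := by
  nth_rw 2 [← starProjection_verticalSpace_add_starProjection_horizontalSpace (J := J) (F := F) v]
  rw [map_add, mem_verticalSpace.1 (Submodule.starProjection_apply_mem _ v), zero_add]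

theorem IsVerticalField.verticalPart_eq [IsManifold I ∞ M] {V : Π x : M, TangentSpace I x}
    (hV : IsVerticalField I J F V) : verticalPart I J F V = V :=
  funext fun x ↦ Submodule.starProjection_eq_self_iff.2 (hV.mem x)

theorem IsHorizontalField.horizontalPart_eq [IsManifold I ∞ M] {X : Π x : M, TangentSpace I x}
    (hX : IsHorizontalField I J F X) : horizontalPart I J F X = X :=
  funext fun x ↦ Submodule.starProjection_eq_self_iff.2 (hX.mem x)

theorem IsHorizontalField.verticalPart_eq_zero [IsManifold I ∞ M] {X : Π x : M, TangentSpace I x}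
    (hX : IsHorizontalField I J F X) : verticalPart I J F X = 0 :=
  funext fun x ↦ (Submodule.starProjection_apply_eq_zero_iff _).2 (hX.mem x)

variable [FiniteDimensional ℝ E'] [RiemannianBundle (fun y : N ↦ TangentSpace J y)]

variable (I J F) in
/-- The adjoint of the differential of `F`. It is the horizontal lift of tangent vectors when `F`
is a Riemannian submersion; the adjoint makes sense, and depends smoothly on the point, without
mentioning the horizontal spaces. -/
def horizontalLift (x : M) : TangentSpace J (F x) →ₗ[ℝ] TangentSpace I x :=
  LinearMap.adjoint (mfderiv I J F x : TangentSpace I x →ₗ[ℝ] TangentSpace J (F x))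

theorem inner_horizontalLift_left {x : M} (w : TangentSpace J (F x)) (v : TangentSpace I x) :
    inner ℝ (horizontalLift I J F x w) v = inner ℝ w (mfderiv I J F x v) :=
  LinearMap.adjoint_inner_left _ _ _

theorem inner_horizontalLift_right {x : M} (v : TangentSpace I x) (w : TangentSpace J (F x)) :
    inner ℝ v (horizontalLift I J F x w) = inner ℝ (mfderiv I J F x v) w :=
  LinearMap.adjoint_inner_right _ _ _

theorem contMDiffAt_horizontalLift [IsManifold I ∞ M] [IsManifold J ∞ N]
    [IsContMDiffRiemannianBundle I ∞ E (fun x : M ↦ TangentSpace I x)]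
    [IsContMDiffRiemannianBundle J ∞ E' (fun y : N ↦ TangentSpace J y)]
    (hF : ContMDiff I J ∞ F) {s : Π q : M, TangentSpace J (F q)} {p : M}
    (hs : ContMDiffAt I J.tangent ∞ (fun q ↦ (⟨F q, s q⟩ : TangentBundle J N)) p) :
    CMDiffAt ∞ (T% (fun q ↦ horizontalLift I J F q (s q))) p := by
  refine contMDiffAt_of_contMDiffAt_inner (F := E) (E := fun x : M ↦ TangentSpace I x)
    fun Z hZ ↦ ?_
  simp only [inner_horizontalLift_right]
  exact ContMDiffAt.inner_bundle (IB := J) (F := E') (E := fun y : N ↦ TangentSpace J y)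
    (contMDiffAt_mfderiv_apply hF (by simp) hZ) hs

variable (I J F) in
/-- The horizontal lift to `M` of a vector field `Z` on `N`: when `F` is a Riemannian submersion,
the basic vector field that is `F`-related to `Z`. -/
def basicField (Z : Π y : N, TangentSpace J y) : Π x : M, TangentSpace I x :=
  fun x ↦ horizontalLift I J F x (Z (F x))

theorem mdifferentiableAt_basicField [IsManifold I ∞ M] [IsManifold J ∞ N]
    [IsContMDiffRiemannianBundle I ∞ E (fun x : M ↦ TangentSpace I x)]
    [IsContMDiffRiemannianBundle J ∞ E' (fun y : N ↦ TangentSpace J y)]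
    (hF : ContMDiff I J ∞ F) {Z : Π y : N, TangentSpace J y} {p : M}
    (hZ : CMDiffAt ∞ (T% Z) (F p)) :
    MDiffAt (T% (basicField I J F Z)) p :=
  (contMDiffAt_horizontalLift hF (hZ.comp p hF.contMDiffAt)).mdifferentiableAt (by simp)

namespace IsRiemannianSubmersion

theorem horizontalLift_mfderiv (hF : IsRiemannianSubmersion I J F) {x : M} (v : TangentSpace I x) :
    horizontalLift I J F x (mfderiv I J F x v) = (horizontalSpace I J F x).starProjection v := by
  refine ext_inner_right ℝ fun u ↦ ?_
  have hv := (horizontalSpace I J F x).starProjection_apply_mem v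
  rw [inner_horizontalLift_left, ← mfderiv_starProjection_horizontalSpace v,
    ← mfderiv_starProjection_horizontalSpace u,
    hF.inner_mfderiv hv (Submodule.starProjection_apply_mem _ _),
    ← Submodule.inner_starProjection_left_eq_right, Submodule.starProjection_eq_self_iff.2 hv]

theorem mfderiv_horizontalLift (hF : IsRiemannianSubmersion I J F) {x : M}
    (w : TangentSpace J (F x)) : mfderiv I J F x (horizontalLift I J F x w) = w := by
  obtain ⟨v, rfl⟩ := hF.surjective_mfderiv x w
  rw [hF.horizontalLift_mfderiv, mfderiv_starProjection_horizontalSpace]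

theorem mfderiv_basicField (hF : IsRiemannianSubmersion I J F) (Z : Π y : N, TangentSpace J y)
    (x : M) : mfderiv I J F x (basicField I J F Z x) = Z (F x) :=
  hF.mfderiv_horizontalLift _

theorem inner_basicField (hF : IsRiemannianSubmersion I J F) (Y Z : Π y : N, TangentSpace J y)
    (x : M) :
    inner ℝ (basicField I J F Y x) (basicField I J F Z x) = inner ℝ (Y (F x)) (Z (F x)) := by
  rw [basicField, inner_horizontalLift_left, hF.mfderiv_basicField]

theorem mvfderiv_inner_basicField [IsManifold J ∞ N]
    [IsContMDiffRiemannianBundle J ∞ E' (fun y : N ↦ TangentSpace J y)]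
    (hF : IsRiemannianSubmersion I J F) (X : Π y : N, TangentSpace J y)
    {Y Z : Π y : N, TangentSpace J y} {p : M} (hY : MDiffAt (T% Y) (F p))
    (hZ : MDiffAt (T% Z) (F p)) :
    mvfderiv I (fun q ↦ (inner ℝ (basicField I J F Y q) (basicField I J F Z q) : ℝ)) p
        (basicField I J F X p) =
      mvfderiv J (fun y ↦ (inner ℝ (Y y) (Z y) : ℝ)) (F p) (X (F p)) := by
  simp only [hF.inner_basicField]
  rw [← hF.mfderiv_basicField X p]
  exact mvfderiv_comp_apply p (mdifferentiableAt_inner J hY hZ)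
    (hF.contMDiff.mdifferentiableAt (by simp)) _

theorem basicField_extend_mfderiv [IsManifold J ∞ N] (hF : IsRiemannianSubmersion I J F)
    {x : M} (v : TangentSpace I x) :
    basicField I J F (FiberBundle.extend E' (mfderiv I J F x v)) x =
      (horizontalSpace I J F x).starProjection v := by
  rw [basicField, FiberBundle.extend_apply_self, hF.horizontalLift_mfderiv]

variable [IsManifold I ∞ M] [IsManifold J ∞ N]
  [IsContMDiffRiemannianBundle I ∞ E (fun x : M ↦ TangentSpace I x)]
  [IsContMDiffRiemannianBundle J ∞ E' (fun y : N ↦ TangentSpace J y)]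

theorem isHorizontalField_horizontalPart (hF : IsRiemannianSubmersion I J F)
    {X : Π x : M, TangentSpace I x} (hX : IsSmoothField I X) :
    IsHorizontalField I J F (horizontalPart I J F X) where
  smooth p := by
    have := contMDiffAt_horizontalLift hF.contMDiff
      (contMDiffAt_mfderiv_apply hF.contMDiff (by simp) (hX p))
    simp only [hF.horizontalLift_mfderiv] at this
    exact this
  mem _ := Submodule.starProjection_apply_mem _ _

theorem isVerticalField_verticalPart (hF : IsRiemannianSubmersion I J F)
    {X : Π x : M, TangentSpace I x} (hX : IsSmoothField I X) :
    IsVerticalField I J F (verticalPart I J F X) where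
  smooth := by
    have h : verticalPart I J F X = X - horizontalPart I J F X := funext fun x ↦
      eq_sub_of_add_eq (starProjection_verticalSpace_add_starProjection_horizontalSpace (X x))
    rw [h]
    exact ContMDiff.sub_section hX (hF.isHorizontalField_horizontalPart hX).smooth
  mem _ := Submodule.starProjection_apply_mem _ _

variable [T2Space M]

theorem exists_isVerticalField_eq (hF : IsRiemannianSubmersion I J F) {p : M}
    {v : TangentSpace I p} (hv : v ∈ verticalSpace I J F p) :
    ∃ V : Π x : M, TangentSpace I x, IsVerticalField I J F V ∧ V p = v := by
  obtain ⟨X, hX, rfl⟩ :=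
    exists_contMDiff_section_eq (IB := I) (F := E) (E := fun x : M ↦ TangentSpace I x) v
  exact ⟨_, hF.isVerticalField_verticalPart hX, Submodule.starProjection_eq_self_iff.2 hv⟩

theorem exists_isHorizontalField_eq (hF : IsRiemannianSubmersion I J F) {p : M}
    {v : TangentSpace I p} (hv : v ∈ horizontalSpace I J F p) :
    ∃ X : Π x : M, TangentSpace I x, IsHorizontalField I J F X ∧ X p = v := by
  obtain ⟨X, hX, rfl⟩ :=
    exists_contMDiff_section_eq (IB := I) (F := E) (E := fun x : M ↦ TangentSpace I x) v
  exact ⟨_, hF.isHorizontalField_horizontalPart hX, Submodule.starProjection_eq_self_iff.2 hv⟩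

end IsRiemannianSubmersion

end HorizontalLift

section VectorBundleExtension

variable {B : Type*} [TopologicalSpace B] {F : Type*} [NormedAddCommGroup F]
  {V : B → Type*} [TopologicalSpace (TotalSpace F V)]
  [∀ x, AddCommGroup (V x)] [∀ x, TopologicalSpace (V x)] [FiberBundle F V]

theorem extend_add_eventuallyEq (𝕜 : Type*) [NontriviallyNormedField 𝕜] [NormedSpace 𝕜 F]
    [∀ x, Module 𝕜 (V x)] [VectorBundle 𝕜 F V] {x : B} (u v : V x) :
    ∀ᶠ y in 𝓝 x, FiberBundle.extend F (u + v) y =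
      (FiberBundle.extend F u + FiberBundle.extend F v : Π y, V y) y := by
  let e := trivializationAt F V x
  have hx : x ∈ e.baseSet := FiberBundle.mem_baseSet_trivializationAt' x
  have h : (e ⟨x, u + v⟩).2 = (e ⟨x, u⟩).2 + (e ⟨x, v⟩).2 := (e.linear 𝕜 hx).map_add u v
  filter_upwards [e.open_baseSet.mem_nhds hx] with y hy
  change e.symm y (e ⟨x, u + v⟩).2 = e.symm y (e ⟨x, u⟩).2 + e.symm y (e ⟨x, v⟩).2
  rw [h, ← e.coe_symmₗ (R := 𝕜) hy, map_add]

variable {𝕜 : Type*} [NontriviallyNormedField 𝕜] [NormedSpace 𝕜 F] [∀ x, Module 𝕜 (V x)]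
  [VectorBundle 𝕜 F V]

theorem extend_smul_eventuallyEq {x : B} (a : 𝕜) (v : V x) :
    ∀ᶠ y in 𝓝 x, FiberBundle.extend F (a • v) y = (a • FiberBundle.extend F v : Π y, V y) y := by
  let e := trivializationAt F V x
  have hx : x ∈ e.baseSet := FiberBundle.mem_baseSet_trivializationAt' x
  have h : (e ⟨x, a • v⟩).2 = a • (e ⟨x, v⟩).2 := (e.linear 𝕜 hx).map_smul a v
  filter_upwards [e.open_baseSet.mem_nhds hx] with y hy
  change e.symm y (e ⟨x, a • v⟩).2 = a • e.symm y (e ⟨x, v⟩).2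
  rw [h, ← e.coe_symmₗ (R := 𝕜) hy, map_smul]

variable {EB : Type*} [NormedAddCommGroup EB] [NormedSpace 𝕜 EB]
  {HB : Type*} [TopologicalSpace HB] {IB : ModelWithCorners 𝕜 EB HB} [ChartedSpace HB B]
  [∀ x, IsTopologicalAddGroup (V x)] [∀ x, ContinuousSMul 𝕜 (V x)]

theorem covariantDerivative_extend_add (D : CovariantDerivative IB F V) {x : B} (u v : V x) :
    D (FiberBundle.extend F (u + v)) x =
      D (FiberBundle.extend F u) x + D (FiberBundle.extend F v) x := by
  have hu := FiberBundle.mdifferentiableAt_extend IB F u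
  have hv := FiberBundle.mdifferentiableAt_extend IB F v
  rw [← D.isCovariantDerivativeOnUniv.add hu hv]
  exact D.isCovariantDerivativeOnUniv.congr_of_eventuallyEq
    (FiberBundle.mdifferentiableAt_extend IB F _) (mdifferentiableAt_add_section hu hv)
    Filter.univ_mem (extend_add_eventuallyEq 𝕜 u v)

theorem covariantDerivative_extend_smul (D : CovariantDerivative IB F V) {x : B} (a : 𝕜)
    (v : V x) : D (FiberBundle.extend F (a • v)) x = a • D (FiberBundle.extend F v) x := by
  have hv := FiberBundle.mdifferentiableAt_extend IB F v
  rw [← D.isCovariantDerivativeOnUniv.smul_const a hv]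
  exact D.isCovariantDerivativeOnUniv.congr_of_eventuallyEq
    (FiberBundle.mdifferentiableAt_extend IB F _) (mdifferentiableAt_const.smul_section hv)
    Filter.univ_mem (extend_smul_eventuallyEq a v)

end VectorBundleExtension

section CoordinatesAlong

variable {B : Type*} [TopologicalSpace B] {F : Type*} [NormedAddCommGroup F]
  {V : B → Type*} [TopologicalSpace (TotalSpace F V)] [∀ x, TopologicalSpace (V x)]
  [FiberBundle F V] {M : Type*} {f : M → B}

variable (F) in
/-- The coordinates of a section `s` of `f⁻¹ V`, in the trivialization of `V` at `f p`. The
pullback connection differentiates them as functions with values in the model fiber. -/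
def coordAlong (s : Π q : M, V (f q)) (p q : M) : F :=
  (trivializationAt F V (f p) (⟨f q, s q⟩ : TotalSpace F V)).2

variable [∀ x, AddCommGroup (V x)]

theorem coordAlong_add_eventuallyEq (𝕜 : Type*) [NontriviallyNormedField 𝕜] [NormedSpace 𝕜 F]
    [∀ x, Module 𝕜 (V x)] [VectorBundle 𝕜 F V] [TopologicalSpace M] {p : M} (hf : ContinuousAt f p)
    (s t : Π q : M, V (f q)) :
    coordAlong F (fun q ↦ s q + t q) p =ᶠ[𝓝 p] coordAlong F s p + coordAlong F t p := by
  filter_upwards [hf.eventually_mem ((trivializationAt F V (f p)).open_baseSet.mem_nhds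
    (FiberBundle.mem_baseSet_trivializationAt' (f p)))] with q hq
  exact (Trivialization.linear 𝕜 _ hq).map_add (s q) (t q)

variable {𝕜 : Type*} [NontriviallyNormedField 𝕜] [NormedSpace 𝕜 F] [∀ x, Module 𝕜 (V x)]
  [VectorBundle 𝕜 F V]

variable (𝕜) in
theorem symmL_coordAlong_self (s : Π q : M, V (f q)) (p : M) :
    (trivializationAt F V (f p)).symmL 𝕜 (f p) (coordAlong F s p p) = s p := by
  have hp : f p ∈ (trivializationAt F V (f p)).baseSet :=
    FiberBundle.mem_baseSet_trivializationAt' (f p)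
  rw [Trivialization.symmL_apply _ hp]
  exact Trivialization.symm_apply_apply_mk _ hp (s p)

variable [TopologicalSpace M]

theorem coordAlong_smul_eventuallyEq {p : M} (hf : ContinuousAt f p) (g : M → 𝕜)
    (s : Π q : M, V (f q)) :
    coordAlong F (fun q ↦ g q • s q) p =ᶠ[𝓝 p] g • coordAlong F s p := by
  filter_upwards [hf.eventually_mem ((trivializationAt F V (f p)).open_baseSet.mem_nhds
    (FiberBundle.mem_baseSet_trivializationAt' (f p)))] with q hq
  exact (Trivialization.linear 𝕜 _ hq).map_smul (g q) (s q)

variable {EB : Type*} [NormedAddCommGroup EB] [NormedSpace 𝕜 EB]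
  {HB : Type*} [TopologicalSpace HB] {IB : ModelWithCorners 𝕜 EB HB} [ChartedSpace HB B]
  {EM : Type*} [NormedAddCommGroup EM] [NormedSpace 𝕜 EM]
  {HM : Type*} [TopologicalSpace HM] {IM : ModelWithCorners 𝕜 EM HM} [ChartedSpace HM M]

theorem mdifferentiableAt_coordAlong [IsManifold IB 1 B] [ContMDiffVectorBundle 1 F V IB]
    {s : Π q : M, V (f q)} {p : M}
    (hs : MDifferentiableAt IM (IB.prod 𝓘(𝕜, F)) (fun q ↦ (⟨f q, s q⟩ : TotalSpace F V)) p) :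
    MDifferentiableAt IM 𝓘(𝕜, F) (coordAlong F s p) p :=
  ((mdifferentiableAt_totalSpace IB _).1 hs).2

theorem mvfderiv_congr_of_eventuallyEq {g h : M → F} {p : M} (hgh : g =ᶠ[𝓝 p] h) :
    mvfderiv IM g p = mvfderiv IM h p := by
  ext v
  simp only [mvfderiv, hgh.mfderiv_eq, ContinuousLinearMap.comp_apply]
  rfl

end CoordinatesAlong

section PullbackConnection

variable {E : Type*} [NormedAddCommGroup E] [NormedSpace ℝ E]
  {H : Type*} [TopologicalSpace H] {I : ModelWithCorners ℝ E H}
  {M : Type*} [TopologicalSpace M] [ChartedSpace H M]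
  {E' : Type*} [NormedAddCommGroup E'] [NormedSpace ℝ E'] [FiniteDimensional ℝ E']
  [CompleteSpace E']
  {H' : Type*} [TopologicalSpace H'] {J : ModelWithCorners ℝ E' H'}
  {N : Type*} [TopologicalSpace N] [ChartedSpace H' N] [IsManifold J ∞ N]
  [RiemannianBundle (fun y : N ↦ TangentSpace J y)]
  [IsContMDiffRiemannianBundle J ∞ E' (fun y : N ↦ TangentSpace J y)]
  {F : M → N} {p : M} {s t : Π q : M, TangentSpace J (F q)}

theorem pullbackNabla_eq (s : Π q : M, TangentSpace J (F q)) (v : TangentSpace I p) :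
    pullbackNabla I J F s p v =
      (trivializationAt E' (TangentSpace J : N → Type _) (F p)).symmL ℝ (F p)
        (mvfderiv I (coordAlong E' s p) p v)
      + leviCivita J (FiberBundle.extend E' (s p)) (F p) (mfderiv I J F p v) :=
  rfl

theorem pullbackNabla_add (hF : ContinuousAt F p)
    (hs : MDifferentiableAt I J.tangent (fun q ↦ (⟨F q, s q⟩ : TangentBundle J N)) p)
    (ht : MDifferentiableAt I J.tangent (fun q ↦ (⟨F q, t q⟩ : TangentBundle J N)) p)
    (v : TangentSpace I p) :
    pullbackNabla I J F (fun q ↦ s q + t q) p v =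
      pullbackNabla I J F s p v + pullbackNabla I J F t p v := by
  rw [pullbackNabla_eq, pullbackNabla_eq, pullbackNabla_eq,
    mvfderiv_congr_of_eventuallyEq (coordAlong_add_eventuallyEq ℝ hF s t),
    mvfderiv_add (mdifferentiableAt_coordAlong hs) (mdifferentiableAt_coordAlong ht),
    covariantDerivative_extend_add, add_apply, add_apply, map_add]
  exact add_add_add_comm _ _ _ _

theorem pullbackNabla_smul {f : M → ℝ} (hF : ContinuousAt F p) (hf : MDiffAt f p)
    (hs : MDifferentiableAt I J.tangent (fun q ↦ (⟨F q, s q⟩ : TangentBundle J N)) p)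
    (v : TangentSpace I p) :
    pullbackNabla I J F (fun q ↦ f q • s q) p v =
      f p • pullbackNabla I J F s p v + mvfderiv I f p v • s p := by
  have hcoord : mvfderiv I (f • coordAlong E' s p) p v =
      f p • mvfderiv I (coordAlong E' s p) p v + mvfderiv I f p v • coordAlong E' s p p := by
    rw [mvfderiv_smul hf (mdifferentiableAt_coordAlong hs)]
    rfl
  rw [pullbackNabla_eq, pullbackNabla_eq,
    mvfderiv_congr_of_eventuallyEq (coordAlong_smul_eventuallyEq hF f s), hcoord,
    covariantDerivative_extend_smul, smul_apply, map_add, map_smul, map_smul,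
    symmL_coordAlong_self, smul_add]
  exact add_right_comm _ _ _

end PullbackConnection

section SecondFundamentalForm

open VectorField

variable {E : Type*} [NormedAddCommGroup E] [NormedSpace ℝ E] [FiniteDimensional ℝ E]
  [CompleteSpace E]
  {H : Type*} [TopologicalSpace H] {I : ModelWithCorners ℝ E H}
  {M : Type*} [TopologicalSpace M] [ChartedSpace H M] [IsManifold I ∞ M]
  [RiemannianBundle (fun x : M ↦ TangentSpace I x)]
  [IsContMDiffRiemannianBundle I ∞ E (fun x : M ↦ TangentSpace I x)]
  {E' : Type*} [NormedAddCommGroup E'] [NormedSpace ℝ E']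
  {H' : Type*} [TopologicalSpace H'] {J : ModelWithCorners ℝ E' H'}
  {N : Type*} [TopologicalSpace N] [ChartedSpace H' N]
  {F : M → N}

variable (I J F) in
/-- The vertical distribution `ker F_*` is parallel: `∇_v V` is vertical for every vertical field
`V` and every tangent vector `v`, horizontal or vertical. -/
def HasParallelVerticalDistribution : Prop :=
  ∀ V : Π x : M, TangentSpace I x, IsVerticalField I J F V →
    ∀ (p : M) (v : TangentSpace I p), leviCivita I V p v ∈ verticalSpace I J F p

variable [FiniteDimensional ℝ E'] [CompleteSpace E'] [IsManifold J ∞ N]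
  [RiemannianBundle (fun y : N ↦ TangentSpace J y)]
  [IsContMDiffRiemannianBundle J ∞ E' (fun y : N ↦ TangentSpace J y)]

theorem tensorialAt_secondFundamentalForm (hF : ContMDiff I J ∞ F) (X : Π x : M, TangentSpace I x)
    (p : M) : TensorialAt I E (fun Y ↦ secondFundamentalForm I J F X Y p) p where
  smul {f Y} hf hY := by
    have h := pullbackNabla_smul hF.continuous.continuousAt hf
      (mdifferentiableAt_mfderiv_apply hF ENat.LEInfty.out hY) (X p)
    simp only [secondFundamentalForm, nabla, Pi.smul_apply', map_smul, h,
      (leviCivita I).isCovariantDerivativeOnUniv.leibniz hY hf]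
    simp [smul_sub]
  add {Y Y'} hY hY' := by
    have h := pullbackNabla_add hF.continuous.continuousAt
      (mdifferentiableAt_mfderiv_apply hF ENat.LEInfty.out hY)
      (mdifferentiableAt_mfderiv_apply hF ENat.LEInfty.out hY') (X p)
    simp only [secondFundamentalForm, nabla, Pi.add_apply, map_add, h,
      (leviCivita I).isCovariantDerivativeOnUniv.add hY hY', add_apply]
    exact add_sub_add_comm _ _ _ _

theorem secondFundamentalForm_of_isVerticalField {p : M} (hF : MDiffAt F p)
    {V : Π x : M, TangentSpace I x} (hV : IsVerticalField I J F V)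
    (X : Π x : M, TangentSpace I x) :
    secondFundamentalForm I J F X V p = -mfderiv I J F p (nabla I X V p) := by
  have h : (fun q ↦ mfderiv I J F q (V q)) = fun q ↦ (0 : Π y : N, TangentSpace J y) (F q) :=
    funext hV.mem
  rw [secondFundamentalForm, h,
    pullbackNabla_comp I J F (Y := 0) hF (mdifferentiable_zeroSection ℝ _ _)]
  simp

namespace IsRiemannianSubmersion

variable {p : M} {X Y Z : Π y : N, TangentSpace J y}

theorem inner_mlieBracket_basicField (hF : IsRiemannianSubmersion I J F)
    (hX : CMDiffAt ∞ (T% X) (F p)) (hY : CMDiffAt ∞ (T% Y) (F p)) (Z : Π y : N, TangentSpace J y) :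
    inner ℝ (mlieBracket I (basicField I J F X) (basicField I J F Y) p) (basicField I J F Z p) =
      inner ℝ (mlieBracket J X Y (F p)) (Z (F p)) := by
  rw [basicField.eq_def I J F Z, inner_horizontalLift_right,
    mfderiv_mlieBracket_of_related hF.contMDiff.contMDiffAt
      (by simpa using ENat.LEInfty.out)
      (mdifferentiableAt_basicField hF.contMDiff hX) (mdifferentiableAt_basicField hF.contMDiff hY)
      (hX.mdifferentiableAt (by simp)) (hY.mdifferentiableAt (by simp))
      (.of_forall (hF.mfderiv_basicField X)) (.of_forall (hF.mfderiv_basicField Y))]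

theorem koszul_basicField (hF : IsRiemannianSubmersion I J F) (hX : CMDiffAt ∞ (T% X) (F p))
    (hY : CMDiffAt ∞ (T% Y) (F p)) (hZ : CMDiffAt ∞ (T% Z) (F p)) :
    koszul I (basicField I J F X) (basicField I J F Y) (basicField I J F Z) p =
      koszul J X Y Z (F p) := by
  have hX' := hX.mdifferentiableAt (by simp)
  have hY' := hY.mdifferentiableAt (by simp)
  have hZ' := hZ.mdifferentiableAt (by simp)
  rw [koszul, koszul, hF.mvfderiv_inner_basicField X hY' hZ',
    hF.mvfderiv_inner_basicField Y hZ' hX', hF.mvfderiv_inner_basicField Z hX' hY',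
    hF.inner_mlieBracket_basicField hX hY, hF.inner_mlieBracket_basicField hY hZ,
    hF.inner_mlieBracket_basicField hZ hX]

theorem mfderiv_leviCivita_basicField_basicField (hF : IsRiemannianSubmersion I J F)
    (hX : CMDiffAt ∞ (T% X) (F p)) (hY : CMDiffAt ∞ (T% Y) (F p)) :
    mfderiv I J F p (leviCivita I (basicField I J F Y) p (basicField I J F X p)) =
      leviCivita J Y (F p) (X (F p)) := by
  refine ext_inner_right ℝ fun w ↦ ?_
  have hw := FiberBundle.contMDiffAt_extend (k := ∞) J E' w
  rw [← FiberBundle.extend_apply_self E' w, ← inner_horizontalLift_right]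
  have h1 := inner_leviCivita I (mdifferentiableAt_basicField hF.contMDiff hX)
    (mdifferentiableAt_basicField hF.contMDiff hY) (mdifferentiableAt_basicField hF.contMDiff hw)
  have h2 := inner_leviCivita J (hX.mdifferentiableAt (by simp)) (hY.mdifferentiableAt (by simp))
    (hw.mdifferentiableAt (by simp))
  rw [hF.koszul_basicField hX hY hw, ← h2] at h1
  exact h1

theorem mfderiv_leviCivita_basicField_of_mem_horizontalSpace (hF : IsRiemannianSubmersion I J F)
    (hY : CMDiffAt ∞ (T% Y) (F p)) {v : TangentSpace I p} (hv : v ∈ horizontalSpace I J F p) :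
    mfderiv I J F p (leviCivita I (basicField I J F Y) p v) =
      leviCivita J Y (F p) (mfderiv I J F p v) := by
  have h := hF.mfderiv_leviCivita_basicField_basicField
    (FiberBundle.contMDiffAt_extend J E' (mfderiv I J F p v)) hY
  rwa [hF.basicField_extend_mfderiv, Submodule.starProjection_eq_self_iff.2 hv,
    FiberBundle.extend_apply_self] at h

theorem mfderiv_leviCivita_basicField_of_isVerticalField (hF : IsRiemannianSubmersion I J F)
    (hY : CMDiffAt ∞ (T% Y) (F p)) {W : Π x : M, TangentSpace I x} (hW : IsVerticalField I J F W) :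
    mfderiv I J F p (leviCivita I (basicField I J F Y) p (W p)) =
      mfderiv I J F p (leviCivita I W p (basicField I J F Y p)) := by
  have hWp : MDiffAt (T% W) p := hW.smooth.mdifferentiableAt (by simp)
  have hYp := mdifferentiableAt_basicField hF.contMDiff hY
  have htorsion := (CovariantDerivative.torsion_eq_zero_iff _).1 (leviCivita_torsion I) hWp hYp
  have hbracket : mfderiv I J F p (mlieBracket I W (basicField I J F Y) p) = 0 := by
    rw [mfderiv_mlieBracket_of_related hF.contMDiff.contMDiffAt
      (by simpa using ENat.LEInfty.out) hWp hYp
      (V' := 0) (mdifferentiable_zeroSection ℝ _ _) (hY.mdifferentiableAt (by simp))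
      (.of_forall hW.mem) (.of_forall (hF.mfderiv_basicField Y)), mlieBracket_zero_left]
    rfl
  rwa [← htorsion, map_sub, sub_eq_zero] at hbracket

variable [T2Space M]

theorem mfderiv_leviCivita_basicField (hF : IsRiemannianSubmersion I J F)
    (hpar : HasParallelVerticalDistribution I J F) (hY : CMDiffAt ∞ (T% Y) (F p))
    (v : TangentSpace I p) :
    mfderiv I J F p (leviCivita I (basicField I J F Y) p v) =
      leviCivita J Y (F p) (mfderiv I J F p v) := by
  obtain ⟨W, hW, hWp⟩ := hF.exists_isVerticalField_eq
    ((verticalSpace I J F p).starProjection_apply_mem v)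
  have hvertical := (hF.mfderiv_leviCivita_basicField_of_isVerticalField hY hW).trans
    (hpar W hW p _)
  have hhorizontal := hF.mfderiv_leviCivita_basicField_of_mem_horizontalSpace hY
    ((horizontalSpace I J F p).starProjection_apply_mem v)
  rw [hWp] at hvertical
  rw [mfderiv_starProjection_horizontalSpace] at hhorizontal
  conv_lhs =>
    rw [← starProjection_verticalSpace_add_starProjection_horizontalSpace (J := J) (F := F) v]
  rw [map_add, map_add, hvertical, hhorizontal, zero_add]

theorem secondFundamentalForm_basicField (hF : IsRiemannianSubmersion I J F)
    (hpar : HasParallelVerticalDistribution I J F) (hY : CMDiffAt ∞ (T% Y) (F p))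
    (X : Π x : M, TangentSpace I x) :
    secondFundamentalForm I J F X (basicField I J F Y) p = 0 := by
  rw [secondFundamentalForm, funext (hF.mfderiv_basicField Y),
    pullbackNabla_comp I J F (hF.contMDiff.mdifferentiableAt (by simp))
      (hY.mdifferentiableAt (by simp)), nabla, hF.mfderiv_leviCivita_basicField hpar hY, sub_self]

theorem isTotallyGeodesicMap_of_hasParallelVerticalDistribution (hF : IsRiemannianSubmersion I J F)
    (hpar : HasParallelVerticalDistribution I J F) : IsTotallyGeodesicMap I J F := by
  intro X Y _ hY p
  obtain ⟨V, hV, hVp⟩ := hF.exists_isVerticalField_eq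
    ((verticalSpace I J F p).starProjection_apply_mem (Y p))
  let B : Π y : N, TangentSpace J y := FiberBundle.extend E' (mfderiv I J F p (Y p))
  have hB : CMDiffAt ∞ (T% B) (F p) := FiberBundle.contMDiffAt_extend J E' _
  have hVd : MDiffAt (T% V) p := hV.smooth.mdifferentiableAt (by simp)
  have hBd := mdifferentiableAt_basicField hF.contMDiff hB
  have hYp : Y p = (V + basicField I J F B) p := by
    rw [Pi.add_apply, hVp, hF.basicField_extend_mfderiv,
      starProjection_verticalSpace_add_starProjection_horizontalSpace]
  have htensor := tensorialAt_secondFundamentalForm hF.contMDiff X p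
  calc secondFundamentalForm I J F X Y p
      = secondFundamentalForm I J F X (V + basicField I J F B) p :=
        htensor.pointwise (hY.mdifferentiableAt (by simp))
          (mdifferentiableAt_add_section hVd hBd) hYp
    _ = secondFundamentalForm I J F X V p + secondFundamentalForm I J F X (basicField I J F B) p :=
        htensor.add hVd hBd
    _ = 0 := by
        rw [secondFundamentalForm_of_isVerticalField (hF.contMDiff.mdifferentiableAt (by simp)) hV,
          nabla, mem_verticalSpace.1 (hpar V hV p _), hF.secondFundamentalForm_basicField hpar hB,
          neg_zero, add_zero]

theorem isTotallyGeodesicMap_iff (hF : IsRiemannianSubmersion I J F) :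
    IsTotallyGeodesicMap I J F ↔ HasParallelVerticalDistribution I J F := by
  refine ⟨fun h V hV p v ↦ ?_, hF.isTotallyGeodesicMap_of_hasParallelVerticalDistribution⟩
  obtain ⟨X, hX, rfl⟩ :=
    exists_contMDiff_section_eq (IB := I) (F := E) (E := fun x : M ↦ TangentSpace I x) v
  rw [mem_verticalSpace, ← neg_eq_zero, ← h X V hX hV.smooth p,
    secondFundamentalForm_of_isVerticalField (hF.contMDiff.mdifferentiableAt (by simp)) hV, nabla]

end IsRiemannianSubmersion

end SecondFundamentalForm

section ONeillTensors

variable {E : Type*} [NormedAddCommGroup E] [NormedSpace ℝ E]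
  {H : Type*} [TopologicalSpace H] {I : ModelWithCorners ℝ E H}
  {M : Type*} [TopologicalSpace M] [ChartedSpace H M] [IsManifold I ∞ M]
  [RiemannianBundle (fun x : M ↦ TangentSpace I x)]
  {E' : Type*} [NormedAddCommGroup E'] [NormedSpace ℝ E']
  {H' : Type*} [TopologicalSpace H'] {J : ModelWithCorners ℝ E' H'}
  {N : Type*} [TopologicalSpace N] [ChartedSpace H' N]
  {F : M → N} {V W X Z : Π x : M, TangentSpace I x}
  {phi : Π x : M, TangentSpace I x →L[ℝ] TangentSpace I x}

theorem IsVerticalField.isHorizontalField_apply (hV : IsVerticalField I J F V)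
    (hphi : ContMDiff I (I.prod 𝓘(ℝ, E →L[ℝ] E)) ∞ (fun x ↦ (⟨x, phi x⟩ :
      TotalSpace (E →L[ℝ] E) (fun x : M ↦ TangentSpace I x →L[ℝ] TangentSpace I x))))
    (hmap : ∀ x, (verticalSpace I J F x).map
      (phi x : TangentSpace I x →ₗ[ℝ] TangentSpace I x) ≤ horizontalSpace I J F x) :
    IsHorizontalField I J F (fun x ↦ phi x (V x)) where
  smooth x := ContMDiffAt.clm_bundle_apply (F₁ := E) (F₂ := E) (hphi x) (hV.smooth x)
  mem x := hmap x (Submodule.mem_map_of_mem (hV.mem x))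

variable [FiniteDimensional ℝ E] [CompleteSpace E]
  [IsContMDiffRiemannianBundle I ∞ E (fun x : M ↦ TangentSpace I x)]

theorem oneillT_apply_of_isHorizontalField (hW : IsVerticalField I J F W)
    (hZ : IsHorizontalField I J F Z) (p : M) :
    oneillT I J F W Z p = (verticalSpace I J F p).starProjection (leviCivita I Z p (W p)) := by
  rw [oneillT, hW.verticalPart_eq, hZ.horizontalPart_eq, hZ.verticalPart_eq_zero]
  simp [verticalPart, horizontalPart, nabla]

theorem oneillA_apply_of_isHorizontalField (hX : IsHorizontalField I J F X)
    (hZ : IsHorizontalField I J F Z) (p : M) :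
    oneillA I J F X Z p = (verticalSpace I J F p).starProjection (leviCivita I Z p (X p)) := by
  rw [oneillA, hX.horizontalPart_eq, hZ.horizontalPart_eq, hZ.verticalPart_eq_zero]
  simp [verticalPart, horizontalPart, nabla]

theorem inner_leviCivita_eq_neg (hV : IsVerticalField I J F V) (hZ : IsHorizontalField I J F Z)
    (p : M) (v : TangentSpace I p) :
    inner ℝ (V p) (leviCivita I Z p v) = -inner ℝ (leviCivita I V p v) (Z p) := by
  have hmetric := leviCivita_metric I (FiberBundle.mdifferentiableAt_extend I E v)
    (hV.smooth.mdifferentiableAt (x := p) (by simp)) (hZ.smooth.mdifferentiableAt (by simp))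
  have horth : (fun y ↦ (inner ℝ (V y) (Z y) : ℝ)) = fun _ ↦ 0 :=
    funext fun y ↦ Submodule.inner_right_of_mem_orthogonal (hV.mem y) (hZ.mem y)
  rw [horth, mvfderiv_const, FiberBundle.extend_apply_self, zero_apply] at hmetric
  exact eq_neg_of_add_eq_zero_right hmetric.symm

namespace IsRiemannianSubmersion

variable [FiniteDimensional ℝ E'] [IsManifold J ∞ N] [T2Space M]
  [RiemannianBundle (fun y : N ↦ TangentSpace J y)]
  [IsContMDiffRiemannianBundle J ∞ E' (fun y : N ↦ TangentSpace J y)]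

theorem oneillT_eq_zero_and_oneillA_eq_zero_iff (hF : IsRiemannianSubmersion I J F)
    (hZ : IsHorizontalField I J F Z) :
    ((∀ W, IsVerticalField I J F W → oneillT I J F W Z = 0) ∧
        ∀ X, IsHorizontalField I J F X → oneillA I J F X Z = 0) ↔
      ∀ (p : M) (v : TangentSpace I p), leviCivita I Z p v ∈ horizontalSpace I J F p := by
  simp only [horizontalSpace, ← Submodule.starProjection_apply_eq_zero_iff]
  refine ⟨fun ⟨hT, hA⟩ p v ↦ ?_,
    fun h ↦ ⟨fun W hW ↦ funext fun p ↦ ?_, fun X hX ↦ funext fun p ↦ ?_⟩⟩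
  · obtain ⟨W, hW, hWp⟩ := hF.exists_isVerticalField_eq
      ((verticalSpace I J F p).starProjection_apply_mem v)
    obtain ⟨X, hX, hXp⟩ := hF.exists_isHorizontalField_eq
      ((horizontalSpace I J F p).starProjection_apply_mem v)
    have hvertical := congrFun (hT W hW) p
    have hhorizontal := congrFun (hA X hX) p
    rw [oneillT_apply_of_isHorizontalField hW hZ, hWp] at hvertical
    rw [oneillA_apply_of_isHorizontalField hX hZ, hXp] at hhorizontal
    rw [← starProjection_verticalSpace_add_starProjection_horizontalSpace (J := J) (F := F) v,
      map_add, map_add, hvertical, hhorizontal]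
    exact add_zero 0
  · exact (oneillT_apply_of_isHorizontalField hW hZ p).trans (h p _)
  · exact (oneillA_apply_of_isHorizontalField hX hZ p).trans (h p _)

theorem hasParallelVerticalDistribution_iff (hF : IsRiemannianSubmersion I J F)
    (hphi : ContMDiff I (I.prod 𝓘(ℝ, E →L[ℝ] E)) ∞ (fun x ↦ (⟨x, phi x⟩ :
      TotalSpace (E →L[ℝ] E) (fun x : M ↦ TangentSpace I x →L[ℝ] TangentSpace I x))))
    (hmap : ∀ x, (verticalSpace I J F x).map
      (phi x : TangentSpace I x →ₗ[ℝ] TangentSpace I x) = horizontalSpace I J F x) :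
    HasParallelVerticalDistribution I J F ↔
      ∀ V, IsVerticalField I J F V → ∀ (p : M) (v : TangentSpace I p),
        leviCivita I (fun x ↦ phi x (V x)) p v ∈ horizontalSpace I J F p := by
  have hphiV {V} (hV : IsVerticalField I J F V) : IsHorizontalField I J F (fun x ↦ phi x (V x)) :=
    hV.isHorizontalField_apply hphi fun x ↦ (hmap x).le
  refine ⟨fun hpar V hV p v ↦ ?_, fun h V hV p v ↦ ?_⟩
  · refine (Submodule.mem_orthogonal _ _).2 fun u hu ↦ ?_
    obtain ⟨U, hU, rfl⟩ := hF.exists_isVerticalField_eq hu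
    rw [inner_leviCivita_eq_neg hU (hphiV hV), neg_eq_zero]
    exact Submodule.inner_right_of_mem_orthogonal (hpar U hU p v) ((hphiV hV).mem p)
  · rw [← Submodule.orthogonal_orthogonal (verticalSpace I J F p)]
    refine (Submodule.mem_orthogonal' _ _).2 fun z hz ↦ ?_
    obtain ⟨u, hu, rfl⟩ := Submodule.mem_map.1 ((hmap p).ge hz)
    obtain ⟨U, hU, rfl⟩ := hF.exists_isVerticalField_eq hu
    have hdual := inner_leviCivita_eq_neg hV (hphiV hU) p v
    rw [Submodule.inner_right_of_mem_orthogonal (hV.mem p) (h U hU p v)] at hdual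
    exact neg_eq_zero.1 hdual.symm

end IsRiemannianSubmersion

end ONeillTensors

end RiemGeom

end

open RiemGeom in
theorem theorem6_general
    {E : Type*} [NormedAddCommGroup E] [NormedSpace ℝ E] [FiniteDimensional ℝ E] [CompleteSpace E]
    {H : Type*} [TopologicalSpace H] {I : ModelWithCorners ℝ E H}
    {M : Type*} [TopologicalSpace M] [T2Space M] [ChartedSpace H M] [IsManifold I ∞ M]
    [RiemannianBundle (fun x : M ↦ TangentSpace I x)]
    [IsContMDiffRiemannianBundle I ∞ E (fun x : M ↦ TangentSpace I x)]
    {E' : Type*} [NormedAddCommGroup E'] [NormedSpace ℝ E'] [FiniteDimensional ℝ E']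
    [CompleteSpace E']
    {H' : Type*} [TopologicalSpace H'] {J : ModelWithCorners ℝ E' H'}
    {N : Type*} [TopologicalSpace N] [ChartedSpace H' N] [IsManifold J ∞ N]
    [RiemannianBundle (fun y : N ↦ TangentSpace J y)]
    [IsContMDiffRiemannianBundle J ∞ E' (fun y : N ↦ TangentSpace J y)]
    {F : M → N} {phi : Π x : M, TangentSpace I x →L[ℝ] TangentSpace I x}
    (hF : IsRiemannianSubmersion I J F)
    (hphi : ContMDiff I (I.prod 𝓘(ℝ, E →L[ℝ] E)) ∞ (fun x ↦ (⟨x, phi x⟩ :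
      TotalSpace (E →L[ℝ] E) (fun x : M ↦ TangentSpace I x →L[ℝ] TangentSpace I x))))
    (hmap : ∀ x, (verticalSpace I J F x).map
      (phi x : TangentSpace I x →ₗ[ℝ] TangentSpace I x) = horizontalSpace I J F x) :
    IsTotallyGeodesicMap I J F ↔
      (∀ W V : Π x : M, TangentSpace I x, IsVerticalField I J F W → IsVerticalField I J F V →
        oneillT I J F W (fun x ↦ phi x (V x)) = 0) ∧
      (∀ X W : Π x : M, TangentSpace I x, IsHorizontalField I J F X → IsVerticalField I J F W →
        oneillA I J F X (fun x ↦ phi x (W x)) = 0) := by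
  have hvanish V (hV : IsVerticalField I J F V) :=
    hF.oneillT_eq_zero_and_oneillA_eq_zero_iff
      (hV.isHorizontalField_apply hphi fun x ↦ (hmap x).le)
  rw [hF.isTotallyGeodesicMap_iff, hF.hasParallelVerticalDistribution_iff hphi hmap]
  refine ⟨fun h ↦ ⟨fun W V hW hV ↦ ?_, fun X V hX hV ↦ ?_⟩, fun ⟨hT, hA⟩ V hV ↦ ?_⟩
  · exact ((hvanish V hV).2 (h V hV)).1 W hW
  · exact ((hvanish V hV).2 (h V hV)).2 X hX
  · exact (hvanish V hV).1 ⟨fun W hW ↦ hT W V hW hV, fun X hX ↦ hA X V hX hV⟩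

open RiemGeom in
theorem theorem6 (m n : ℕ)
    {M : Type*} [TopologicalSpace M] [T2Space M]
    [ChartedSpace (EuclideanSpace ℝ (Fin (2 * m + 1))) M] [IsManifold (𝓡 (2 * m + 1)) ∞ M]
    [RiemannianBundle (fun x : M ↦ TangentSpace (𝓡 (2 * m + 1)) x)]
    [IsContMDiffRiemannianBundle (𝓡 (2 * m + 1)) ∞ (EuclideanSpace ℝ (Fin (2 * m + 1)))
      (fun x : M ↦ TangentSpace (𝓡 (2 * m + 1)) x)]
    {N : Type*} [TopologicalSpace N] [T2Space N]
    [ChartedSpace (EuclideanSpace ℝ (Fin n)) N] [IsManifold (𝓡 n) ∞ N]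
    [RiemannianBundle (fun y : N ↦ TangentSpace (𝓡 n) y)]
    [IsContMDiffRiemannianBundle (𝓡 n) ∞ (EuclideanSpace ℝ (Fin n))
      (fun y : N ↦ TangentSpace (𝓡 n) y)]
    (S : AlmostContactMetricStructure (𝓡 (2 * m + 1)) M) (hS : S.IsCosymplectic)
    (F : M → N)
    (hF : IsAntiInvariantRiemannianSubmersion (𝓡 (2 * m + 1)) (𝓡 n) F S)
    (hker : ∀ x : M, (verticalSpace (𝓡 (2 * m + 1)) (𝓡 n) F x).map
        (S.phi x : TangentSpace (𝓡 (2 * m + 1)) x →ₗ[ℝ] TangentSpace (𝓡 (2 * m + 1)) x) =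
      horizontalSpace (𝓡 (2 * m + 1)) (𝓡 n) F x) :
    IsTotallyGeodesicMap (𝓡 (2 * m + 1)) (𝓡 n) F ↔
      (∀ W V : Π x : M, TangentSpace (𝓡 (2 * m + 1)) x,
        IsVerticalField (𝓡 (2 * m + 1)) (𝓡 n) F W →
        IsVerticalField (𝓡 (2 * m + 1)) (𝓡 n) F V →
        oneillT (𝓡 (2 * m + 1)) (𝓡 n) F W (S.phiField V) = 0) ∧
      (∀ X W : Π x : M, TangentSpace (𝓡 (2 * m + 1)) x,
        IsHorizontalField (𝓡 (2 * m + 1)) (𝓡 n) F X →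
        IsVerticalField (𝓡 (2 * m + 1)) (𝓡 n) F W →
        oneillA (𝓡 (2 * m + 1)) (𝓡 n) F X (S.phiField W) = 0) :=
  theorem6_general hF.isRiemannianSubmersion S.contMDiff_phi hker
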